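/- Let $a<b$ be real numbers and let $L\in C([a,b]\times\mathbb R\times\mathbb R)$, $L=L(x,u,v)$, satisfy the following two conditions. (H$_1$) $L$ is locally Hölder continuous: for each compact $G\subset[a,b]\times\mathbb R\times\mathbb R$ there are $C=C(G)>0$ and $\alpha=\alpha(G)>0$ such that $$|L(x_1,u_1,v_1)-L(x_2,u_2,v_2)|\le C\big(|x_1-x_2|+|u_1-u_2|+|v_1-v_2|\big)^\alpha$$ for all $(x_1,u_1,v_1),(x_2,u_2,v_2)\in G$. (H$_2$) The partial derivative $L_{vv}$ exists and is continuous on $[a,b]\times\mathbb R\times\mathbb R$, and there is $\mu>0$ such that $L_{vv}\ge\mu$ everywhere. Let $0<\sigma\le 1$ and let $f,g\in C^{1,\sigma}([a,b])$, i.e. $f$ and $g$ are continuously differentiable on $[a,b]$ with $\sigma$-Hölder continuous derivatives. Assume that $f<g$ on $[a,b]$, let $A,B\in\mathbb R$, and put $$\mathcal A_{f,g}:=\big\{u\in W^{1,1}([a,b]):\ u(a)=A,\ u(b)=B,\ f\le u\le g \text{ on } [a,b]\big\},\qquad \mathcal J_L(u):=\int_a^b L(x,u(x),u'(x))\,dx\in\,]-\infty,\infty],$$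 where $W^{1,1}([a,b])$ is identified with the class of absolutely continuous functions on $[a,b]$. Then every solution of the obstacle problem $\inf\{\mathcal J_L(u):u\in\mathcal A_{f,g}\}$, i.e. every $u\in\mathcal A_{f,g}$ with $\mathcal J_L(u)\le\mathcal J_L(v)$ for all $v\in\mathcal A_{f,g}$, has Tonelli's partial regularity. That is, with $\Omega_u:=\{x\in[a,b]: u \text{ is differentiable at } x\}$ (derivatives at $a$ and $b$ being one-sided): - $\Omega_u$ is an open subset of $[a,b]$; - $[a,b]\setminus\Omega_u=\{x\in[a,b]: u'(x)=-\infty \text{ or } u'(x)=\infty\}$, where $u'(x)=\pm\infty$ means that the difference quotients of $u$ at $x$ tend to $\pm\infty$; - $u':[a,b]\to[-\infty,\infty]$ is continuous. -/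

import Mathlib

open Set Filter Topology MeasureTheory
open scoped NNReal ENNReal

noncomputable section

namespace ObstacleProblem

/-- The domain `[a,b] × ℝ × ℝ` of the Lagrangian; a point is `(x, u, v)`. -/
def domain (a b : ℝ) : Set (ℝ × ℝ × ℝ) := Icc a b ×ˢ univ

/-- Local Hölder continuity: on every compact `G ⊆ [a,b] × ℝ × ℝ` the Lagrangian satisfies a
Hölder estimate, with constant and exponent depending on `G`. -/
def LocallyHolder (a b : ℝ) (L : ℝ × ℝ × ℝ → ℝ) : Prop :=
  ∀ G : Set (ℝ × ℝ × ℝ), IsCompact G → G ⊆ domain a b →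
    ∃ C α : ℝ, 0 < C ∧ 0 < α ∧ ∀ x₁ u₁ v₁ x₂ u₂ v₂ : ℝ,
      (x₁, u₁, v₁) ∈ G → (x₂, u₂, v₂) ∈ G →
        |L (x₁, u₁, v₁) - L (x₂, u₂, v₂)| ≤ C * (|x₁ - x₂| + |u₁ - u₂| + |v₁ - v₂|) ^ α

/-- The partial derivative `F_v` of a function `F(x, u, v)`. -/
def partialV (F : ℝ × ℝ × ℝ → ℝ) (p : ℝ × ℝ × ℝ) : ℝ :=
  deriv (fun v => F (p.1, p.2.1, v)) p.2.2

/-- Global ellipticity: `L_vv` exists and is continuous on `[a,b] × ℝ × ℝ`, and it is bounded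
below there by a positive constant. -/
structure GloballyElliptic (a b : ℝ) (L : ℝ × ℝ × ℝ → ℝ) : Prop where
  differentiable : ∀ x ∈ Icc a b, ∀ u : ℝ, Differentiable ℝ (fun v => L (x, u, v))
  differentiable_partialV : ∀ x ∈ Icc a b, ∀ u : ℝ,
    Differentiable ℝ (fun v => partialV L (x, u, v))
  continuousOn_partialVV : ContinuousOn (partialV (partialV L)) (domain a b)
  bounded_below : ∃ μ : ℝ, 0 < μ ∧ ∀ p ∈ domain a b, μ ≤ partialV (partialV L) p

/-- `h ∈ C^{1,σ}([a,b])`: continuously differentiable on `[a,b]` (one-sided derivatives at the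
end points), with a `σ`-Hölder continuous derivative. -/
def C1Holder (a b : ℝ) (σ : ℝ≥0) (h : ℝ → ℝ) : Prop :=
  ContDiffOn ℝ 1 h (Icc a b) ∧
    ∃ C : ℝ≥0, HolderOnWith C σ (derivWithin h (Icc a b)) (Icc a b)

/-- The functional `u ↦ ∫_a^b L(x, u(x), u'(x)) dx`, as the difference of the integrals of the
positive and of the negative part. For an elliptic `L` and an absolutely continuous `u` the
second integral is finite, so that the value is a real number or `+∞`. -/
def energy (a b : ℝ) (L : ℝ × ℝ × ℝ → ℝ) (u : ℝ → ℝ) : EReal :=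
  ((∫⁻ x in Icc a b, ENNReal.ofReal (L (x, u x, deriv u x)) : ℝ≥0∞) : EReal) -
    ((∫⁻ x in Icc a b, ENNReal.ofReal (-L (x, u x, deriv u x)) : ℝ≥0∞) : EReal)

/-- The admissible functions: `u ∈ W^{1,1}([a,b])`, i.e. (for the continuous representative) `u`
is absolutely continuous on `[a,b]`, with `u(a) = A`, `u(b) = B` and `f ≤ u ≤ g` on `[a,b]`. -/
def admissible (a b A B : ℝ) (f g : ℝ → ℝ) : Set (ℝ → ℝ) :=
  {u | AbsolutelyContinuousOnInterval u a b ∧ u a = A ∧ u b = B ∧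
    ∀ x ∈ Icc a b, f x ≤ u x ∧ u x ≤ g x}

/-- The solutions of the obstacle problem: admissible functions of least energy. -/
def solutions (a b A B : ℝ) (L : ℝ × ℝ × ℝ → ℝ) (f g : ℝ → ℝ) : Set (ℝ → ℝ) :=
  {u | u ∈ admissible a b A B f g ∧
    ∀ v ∈ admissible a b A B f g, energy a b L u ≤ energy a b L v}

/-- `u'(x) = d` in `[-∞, ∞]`, the derivative being taken relative to `[a,b]` (hence one-sided at
the end points): the difference quotients at `x` tend to `d`. -/
def HasExtDerivAt (a b : ℝ) (u : ℝ → ℝ) (d : EReal) (x : ℝ) : Prop :=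
  Tendsto (fun y => (((u y - u x) / (y - x) : ℝ) : EReal)) (𝓝[Icc a b \ {x}] x) (𝓝 d)

/-- The set `Ω_u` of the points of `[a,b]` at which `u` is differentiable (with a finite
derivative, one-sided at the end points). -/
def diffSet (a b : ℝ) (u : ℝ → ℝ) : Set ℝ :=
  {x | x ∈ Icc a b ∧ DifferentiableWithinAt ℝ u (Icc a b) x}

/-- Tonelli's partial regularity of a function `u ∈ W^{1,1}([a,b])`. -/
structure TonelliPartialRegularity (a b : ℝ) (u : ℝ → ℝ) : Prop where
  /-- `u` belongs to `W^{1,1}([a,b])`. -/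
  absolutelyContinuous : AbsolutelyContinuousOnInterval u a b
  /-- `Ω_u` is relatively open in `[a,b]`. -/
  isOpen_diffSet : IsOpen ((↑) ⁻¹' diffSet a b u : Set (Icc a b))
  /-- Off `Ω_u`, and only there, the derivative is `-∞` or `+∞`. -/
  compl_diffSet : Icc a b \ diffSet a b u =
    {x | x ∈ Icc a b ∧ (HasExtDerivAt a b u ⊥ x ∨ HasExtDerivAt a b u ⊤ x)}
  /-- `u'` is a continuous map from `[a,b]` to `[-∞, ∞]`. -/
  continuous_deriv : ∃ u' : ℝ → EReal,
    (∀ x ∈ Icc a b, HasExtDerivAt a b u (u' x) x) ∧ ContinuousOn u' (Icc a b)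

end ObstacleProblem

end

/-!
Let `u` be a solution, `[s,t]` a short interval, `p` the slope of the chord of `u` over it and
`h = t - s`. The chord itself may violate the obstacles, but the chord clipped to the strip between `f`
and `g` is admissible on `[s,t]`. At a point where an obstacle cuts off the chord, the mean value
theorem shows that the derivative of the obstacle takes values on both sides of `p` nearby; as it is
`σ`-Hölder continuous, the derivative of the clipped chord is within a multiple of `h ^ σ` of `p`
(`abs_deriv_clip_sub_le`). The obstacles thus cost only a power of `h`.

Compare the energy of `u` on `[s,t]` with that of the clipped chord `w`
(`setIntegral_le_of_mem_solutions`). Ellipticity gives the tangent parabola inequality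
`L(x, u, u') ≥ L(x, u, p) + L_v(x, u, p) (u' - p) + (μ / 2) (u' - p)²`, in which no values of `L` at the possibly
unbounded `u'` have to be estimated. If `L_v(x, u, p)` is replaced by its value at `(s, u(s), p)`,
the linear term has integral zero, and the error is absorbed by the quadratic term
(`integral_sq_le_of_comparison`). With crude bounds this yields `∫ (u' - p)² ≤ C h`, where `C`
depends only on a bound `M` for `|p|`; in particular `u` varies by at most `C h` on `[s,t]`. Now the
Hölder continuity of `L`, which carries over to `L_v` by the bound for `L_vv`, improves the estimate
to `∫ (u' - p)² ≤ C h ^ (1 + γ)` for some `γ > 0`, and so the slopes of chords over subintervals of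
at least half the length differ from `p` by at most `C h ^ (γ / 2)`
(`exists_abs_slope_sub_le_of_mem_solutions`). Iterating this over halved intervals, one obtains a
geometric series: a short chord of slope at most `M` in modulus has nearly the same slope as every
chord below it (`rigidSlopes_of_half`).

This rigidity implies the theorem. By a continuity argument it extends to all short chords near the
given one (`RigidSlopes.slope_close`). Hence at every point either the slopes of the chords
shrinking to it are Cauchy, or they tend to infinity in modulus, and then with a constant sign. In
each case they have a limit in `[-∞, ∞]` (`RigidSlopes.exists_tendsto`). Since this is a limit over
all chords near the point, not only over those which end there, it depends continuously on the point
(`RigidSlopes.tonelliPartialRegularity`).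
-/

namespace ObstacleProblem

/-! ### Chord slopes -/

/-- The chords `(s, t)`, `s < t`, of the interval `[a,b]`. -/
def chords (a b : ℝ) : Set (ℝ × ℝ) := {z | a ≤ z.1 ∧ z.1 < z.2 ∧ z.2 ≤ b}

/-- Rigidity of chord slopes: if a sufficiently short chord of `u` has slope at most `M` in absolute
value, then all chords below it, that is, over subintervals, have almost the same slope. -/
def RigidSlopes (a b : ℝ) (u : ℝ → ℝ) : Prop :=
  ∀ M ε : ℝ, 0 < ε → ∃ h > 0, ∀ s x y t : ℝ, a ≤ s → s ≤ x → x < y → y ≤ t → t ≤ b →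
    t - s ≤ h → |slope u s t| ≤ M → |slope u x y - slope u s t| ≤ ε

lemma exists_pos_forall_mul_rpow_le {K γ ε : ℝ} (hK : 0 ≤ K) (hγ : 0 < γ) (hε : 0 < ε) :
    ∃ h > 0, ∀ r, 0 ≤ r → r ≤ h → K * r ^ γ ≤ ε := by
  refine ⟨(ε / (K + 1)) ^ (1 / γ), by positivity, fun r hr hrh => ?_⟩
  have h1 : r ^ γ ≤ ε / (K + 1) := by
    calc r ^ γ ≤ ((ε / (K + 1)) ^ (1 / γ)) ^ γ := Real.rpow_le_rpow hr hrh hγ.le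
      _ = ε / (K + 1) := by
        rw [← Real.rpow_mul (by positivity), one_div, inv_mul_cancel₀ hγ.ne', Real.rpow_one]
  calc K * r ^ γ ≤ K * (ε / (K + 1)) := by gcongr
    _ ≤ (K + 1) * (ε / (K + 1)) := by gcongr; linarith
    _ = ε := by field_simp

/-- A power-type comparison of a chord with the chords below it of at least half the length can be
iterated along nested intervals of halved lengths: the errors form a geometric series, so the slopes
stay bounded along the way and the comparison extends to all chords below the given one. -/
theorem rigidSlopes_of_half {a b : ℝ} {u : ℝ → ℝ}
    (H : ∀ M : ℝ, 0 ≤ M → ∃ C γ h₀ : ℝ, 0 ≤ C ∧ 0 < γ ∧ 0 < h₀ ∧ ∀ s x y t : ℝ,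
      a ≤ s → s ≤ x → x < y → y ≤ t → t ≤ b → (t - s) / 2 ≤ y - x → t - s ≤ h₀ →
      |slope u s t| ≤ M → |slope u x y - slope u s t| ≤ C * (t - s) ^ γ) :
    RigidSlopes a b u := by
  intro M ε hε
  obtain ⟨C, γ, h₀, hC, hγ, hh₀, hH⟩ := H (|M| + 1) (by positivity)
  set q : ℝ := (1 / 2) ^ γ with hq
  have hq1 : q < 1 := Real.rpow_lt_one (by norm_num) (by norm_num) hγ
  have hq0 : 0 ≤ q := by positivity
  set K : ℝ := C / (1 - q) with hKdef
  have hK0 : 0 ≤ K := div_nonneg hC (by linarith)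
  have hKC : K = C + K * q := by
    have : K * (1 - q) = C := div_mul_cancel₀ C (by linarith)
    linarith
  have key : ∀ n : ℕ, ∀ s x y t : ℝ, a ≤ s → s ≤ x → x < y → y ≤ t → t ≤ b →
      t - s ≤ 2 ^ n * (y - x) → t - s ≤ h₀ → |slope u s t| + K * (t - s) ^ γ ≤ |M| + 1 →
      |slope u x y - slope u s t| ≤ K * (t - s) ^ γ := by
    intro n
    induction n with
    | zero =>
      intro s x y t has hsx hxy hyt htb hn hh hb
      have h1 : s = x := by simp at hn; linarith
      have h2 : t = y := by simp at hn; linarith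
      subst h1 h2
      have : 0 ≤ (t - s) ^ γ := Real.rpow_nonneg (by linarith) _
      simp only [sub_self, abs_zero]; positivity
    | succ n ih =>
      intro s x y t has hsx hxy hyt htb hn hh hb
      have hpow : 0 ≤ (t - s) ^ γ := Real.rpow_nonneg (by linarith) _
      have hKp : 0 ≤ K * (t - s) ^ γ := by positivity
      by_cases hhalf : (t - s) / 2 ≤ y - x
      · refine (hH s x y t has hsx hxy hyt htb hhalf hh (by linarith)).trans ?_
        gcongr
        rw [hKC]
        linarith [mul_nonneg hK0 hq0]
      · push Not at hhalf
        set s' := max s (y - (t - s) / 2) with hs'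
        have e1 : s ≤ s' := le_max_left _ _
        have e2 : y - (t - s) / 2 ≤ s' := le_max_right _ _
        have e3 : s' ≤ x := max_le hsx (by linarith)
        have e4 : s' + (t - s) / 2 ≤ t := by
          rcases max_choice s (y - (t - s) / 2) with h | h <;> rw [hs', h] <;> linarith
        have hA := hH s s' (s' + (t - s) / 2) t has e1 (by linarith) e4 htb (by linarith) hh
          (by linarith)
        have hlen : (s' + (t - s) / 2 - s') ^ γ = q * (t - s) ^ γ := by
          rw [hq, ← Real.mul_rpow (by norm_num) (by linarith)]; congr 1; ring
        have hB := ih s' x y (s' + (t - s) / 2) (by linarith) e3 hxy (by linarith) (by linarith)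
          (by rw [pow_succ] at hn; linarith) (by linarith) (by
            rw [hlen]
            have := abs_sub_abs_le_abs_sub (slope u s' (s' + (t - s) / 2)) (slope u s t)
            have e5 : K * (t - s) ^ γ = C * (t - s) ^ γ + K * (q * (t - s) ^ γ) := by
              nth_rewrite 1 [hKC]; ring
            linarith)
        rw [hlen] at hB
        have e5 : K * (t - s) ^ γ = C * (t - s) ^ γ + K * (q * (t - s) ^ γ) := by
          nth_rewrite 1 [hKC]; ring
        have := abs_sub_le (slope u x y) (slope u s' (s' + (t - s) / 2)) (slope u s t)
        linarith
  obtain ⟨h₁, hh₁, hK₁⟩ := exists_pos_forall_mul_rpow_le hK0 hγ (lt_min hε one_pos)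
  refine ⟨min h₀ h₁, lt_min hh₀ hh₁, fun s x y t has hsx hxy hyt htb hh hM => ?_⟩
  have h1 := hK₁ (t - s) (by linarith) (hh.trans (min_le_right _ _))
  obtain ⟨n, hn⟩ := pow_unbounded_of_one_lt ((t - s) / (y - x)) (one_lt_two : (1 : ℝ) < 2)
  have hn' : t - s ≤ 2 ^ n * (y - x) := by
    rw [div_lt_iff₀ (by linarith)] at hn
    exact hn.le
  refine (key n s x y t has hsx hxy hyt htb hn' (hh.trans (min_le_left _ _)) ?_).trans
    (h1.trans (min_le_left _ _))
  have := h1.trans (min_le_right _ _)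
  linarith [le_abs_self M]

lemma continuousOn_slope_chords {a b : ℝ} {u : ℝ → ℝ} (hu : ContinuousOn u (Icc a b)) :
    ContinuousOn (fun z : ℝ × ℝ => slope u z.1 z.2) (chords a b) := by
  simp only [slope_def_field]
  refine ContinuousOn.div (ContinuousOn.sub ?_ ?_) (by fun_prop)
    fun z hz => (sub_pos.2 hz.2.1).ne'
  · exact hu.comp continuousOn_snd fun z hz => ⟨hz.1.trans hz.2.1.le, hz.2.2⟩
  · exact hu.comp continuousOn_fst fun z hz => ⟨hz.1, hz.2.1.le.trans hz.2.2⟩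

lemma convex_chords (a b : ℝ) : Convex ℝ (chords a b) := by
  intro z hz w hw p q hp hq hpq
  obtain ⟨hz1, hz2, hz3⟩ := hz
  obtain ⟨hw1, hw2, hw3⟩ := hw
  have hq' : q = 1 - p := by linarith
  subst hq'
  refine ⟨?_, ?_, ?_⟩ <;> simp only [Prod.fst_add, Prod.snd_add, Prod.smul_fst, Prod.smul_snd,
    smul_eq_mul]
  · nlinarith
  · rcases hp.eq_or_lt with rfl | hp'
    · simpa using hw2
    · nlinarith
  · nlinarith

/-- Under rigidity a chord of moderate slope controls all nearby chords, not only those below it: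
when the chord is enlarged continuously, its slope cannot reach the value `M + 1` in modulus, as
rigidity would then force the slope of the original chord to exceed `M`. -/
theorem RigidSlopes.slope_close {a b : ℝ} {u : ℝ → ℝ} (hQ : RigidSlopes a b u)
    (hu : ContinuousOn u (Icc a b)) (M : ℝ) {ε : ℝ} (hε : 0 < ε) :
    ∃ h > 0, ∀ z ∈ chords a b, ∀ w ∈ chords a b, max z.2 w.2 - min z.1 w.1 ≤ h →
      |slope u z.1 z.2| ≤ M → |slope u w.1 w.2 - slope u z.1 z.2| ≤ ε := by
  obtain ⟨h, hh, hQh⟩ := hQ (M + 1) (min (ε / 2) (1 / 2)) (by positivity)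
  refine ⟨h, hh, fun z hz w hw hzw hM => ?_⟩
  set s := min z.1 w.1
  set t := max z.2 w.2
  have hs1 : s ≤ z.1 := min_le_left _ _
  have hs2 : s ≤ w.1 := min_le_right _ _
  have ht1 : z.2 ≤ t := le_max_left _ _
  have ht2 : w.2 ≤ t := le_max_right _ _
  have has : a ≤ s := le_min hz.1 hw.1
  have htb : t ≤ b := max_le hz.2.2 hw.2.2
  have hst : (s, t) ∈ chords a b := ⟨has, hs1.trans_lt (hz.2.1.trans_le ht1), htb⟩
  have hbound : |slope u s t| ≤ M + 1 := by
    by_contra! hcon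
    -- the chords between `z` and the hull `(s, t)` form a connected set
    set S : Set (ℝ × ℝ) := chords a b ∩ (Icc s z.1 ×ˢ Icc z.2 t)
    have hS : IsPreconnected S :=
      ((convex_chords a b).inter ((convex_Icc _ _).prod (convex_Icc _ _))).isPreconnected
    have hcont : ContinuousOn (fun z : ℝ × ℝ => |slope u z.1 z.2|) S :=
      ((continuousOn_slope_chords hu).mono inter_subset_left).abs
    obtain ⟨v, hv, hvM⟩ := hS.intermediate_value (a := z) (b := (s, t))
      ⟨hz, ⟨hs1, le_rfl⟩, ⟨le_rfl, ht1⟩⟩ ⟨hst, ⟨le_rfl, hs1⟩, ⟨ht1, le_rfl⟩⟩ hcont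
      (⟨by linarith, hcon.le⟩ : M + 1 ∈ Icc |slope u z.1 z.2| |slope u s t|)
    obtain ⟨⟨hv1, hv2, hv3⟩, ⟨hv4, hv5⟩, hv6, hv7⟩ := hv
    have h1 := (hQh v.1 z.1 z.2 v.2 hv1 hv5 hz.2.1 hv6 hv3 (by linarith) hvM.le).trans
      (min_le_right _ _)
    have h2 := abs_sub_abs_le_abs_sub (slope u v.1 v.2) (slope u z.1 z.2)
    rw [abs_sub_comm] at h2
    simp only at hvM
    linarith
  have h1 := (hQh s z.1 z.2 t has hs1 hz.2.1 ht1 htb hzw hbound).trans (min_le_left _ _)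
  have h2 := (hQh s w.1 w.2 t has hs2 hw.2.1 ht2 htb hzw hbound).trans (min_le_left _ _)
  rw [abs_sub_comm] at h1
  have := abs_sub_le (slope u w.1 w.2) (slope u s t) (slope u z.1 z.2)
  linarith

lemma max_snd_sub_min_fst_le {x h : ℝ} {z w : ℝ × ℝ} (hz : z ∈ Metric.ball (x, x) (h / 2))
    (hw : w ∈ Metric.ball (x, x) (h / 2)) :
    max z.2 w.2 - min z.1 w.1 ≤ h := by
  simp only [Metric.mem_ball, Prod.dist_eq, max_lt_iff, Real.dist_eq, abs_lt] at hz hw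
  have h1 : max z.2 w.2 ≤ x + h / 2 := max_le (by linarith) (by linarith)
  have h2 : x - h / 2 ≤ min z.1 w.1 := le_min (by linarith) (by linarith)
  linarith

/-- Under rigidity the slopes of the chords shrinking to a point converge in `[-∞, ∞]`. Either
chords of bounded slope occur arbitrarily close to the point, and the slopes form a Cauchy filter,
or the slopes tend to infinity in modulus, with a constant sign since the chords form a convex set.
-/
theorem RigidSlopes.exists_tendsto {a b : ℝ} {u : ℝ → ℝ} (hQ : RigidSlopes a b u)
    (hu : ContinuousOn u (Icc a b)) (x : ℝ) :
    ∃ d : EReal, Tendsto (fun z : ℝ × ℝ => ((slope u z.1 z.2 : ℝ) : EReal))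
      (𝓝[chords a b] (x, x)) (𝓝 d) := by
  by_cases H : ∃ M, ∃ᶠ z in 𝓝[chords a b] (x, x), |slope u z.1 z.2| ≤ M
  · obtain ⟨M, hM⟩ := H
    have hne : (𝓝[chords a b] (x, x)).NeBot := ⟨fun h0 => by simp [h0] at hM⟩
    have hC : Cauchy (map (fun z : ℝ × ℝ => slope u z.1 z.2) (𝓝[chords a b] (x, x))) := by
      refine Metric.cauchy_iff.2 ⟨inferInstance, fun ε hε => ?_⟩
      obtain ⟨h, hh, hclose⟩ := hQ.slope_close hu M (show 0 < ε / 3 by positivity)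
      have hwin : ∀ᶠ z in 𝓝[chords a b] (x, x),
          z ∈ Metric.ball (x, x) (h / 2) ∧ z ∈ chords a b :=
        inter_mem (mem_nhdsWithin_of_mem_nhds (Metric.ball_mem_nhds _ (by positivity)))
          self_mem_nhdsWithin
      obtain ⟨z, hzM, hz1, hz2⟩ := (hM.and_eventually hwin).exists
      refine ⟨_, image_mem_map hwin, ?_⟩
      rintro _ ⟨v, ⟨hv1, hv2⟩, rfl⟩ _ ⟨w, ⟨hw1, hw2⟩, rfl⟩
      have e1 := hclose z hz2 v hv2 (max_snd_sub_min_fst_le hz1 hv1) hzM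
      have e2 := hclose z hz2 w hw2 (max_snd_sub_min_fst_le hz1 hw1) hzM
      rw [abs_sub_comm] at e2
      have := abs_sub_le (slope u v.1 v.2) (slope u z.1 z.2) (slope u w.1 w.2)
      simp only [Real.dist_eq]
      linarith
    obtain ⟨l, hl⟩ := cauchy_map_iff_exists_tendsto.1 hC
    exact ⟨l, (continuous_coe_real_ereal.tendsto l).comp hl⟩
  · push Not at H
    have H' : ∀ M, ∀ᶠ z in 𝓝[chords a b] (x, x), M < |slope u z.1 z.2| := H
    obtain ⟨δ, hδ, hδs⟩ := Metric.mem_nhdsWithin_iff.1 (H' 0)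
    set S := Metric.ball ((x, x) : ℝ × ℝ) δ ∩ chords a b
    have hSF : ∀ᶠ z in 𝓝[chords a b] (x, x), z ∈ S :=
      inter_mem (mem_nhdsWithin_of_mem_nhds (Metric.ball_mem_nhds _ hδ)) self_mem_nhdsWithin
    have hS : IsPreconnected S := ((convex_ball _ _).inter (convex_chords a b)).isPreconnected
    have hcont : ContinuousOn (fun z : ℝ × ℝ => slope u z.1 z.2) S :=
      (continuousOn_slope_chords hu).mono inter_subset_right
    by_cases hpos : ∀ z ∈ S, 0 < slope u z.1 z.2
    · refine ⟨⊤, EReal.tendsto_nhds_top_iff_real.2 fun M => ?_⟩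
      filter_upwards [hSF, H' M] with z hz hM
      rw [abs_of_pos (hpos z hz)] at hM
      exact_mod_cast hM
    · push Not at hpos
      obtain ⟨w, hw, hw0⟩ := hpos
      refine ⟨⊥, EReal.tendsto_nhds_bot_iff_real.2 fun M => ?_⟩
      filter_upwards [hSF, H' (-M)] with z hz hM
      have hneg : slope u z.1 z.2 < 0 := by
        by_contra! hcon
        obtain ⟨v, hv, hv0⟩ := hS.intermediate_value hw hz hcont
          (⟨hw0, hcon⟩ : (0 : ℝ) ∈ Icc (slope u w.1 w.2) (slope u z.1 z.2))
        have := hδs hv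
        simp only at hv0
        simp [hv0] at this
      rw [abs_of_neg hneg] at hM
      have : slope u z.1 z.2 < M := by linarith
      exact_mod_cast this

lemma tendsto_min_max_chords {a b x : ℝ} (hx : x ∈ Icc a b) :
    Tendsto (fun y => (min x y, max x y)) (𝓝[Icc a b \ {x}] x) (𝓝[chords a b] (x, x)) := by
  refine tendsto_nhdsWithin_iff.2 ⟨?_, ?_⟩
  · have : Continuous fun y : ℝ => (min x y, max x y) := by fun_prop
    have h := (this.tendsto x).mono_left (nhdsWithin_le_nhds (s := Icc a b \ {x}))
    simpa using h
  · filter_upwards [self_mem_nhdsWithin] with y hy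
    exact ⟨le_min hx.1 hy.1.1, min_lt_max.2 fun h => hy.2 h.symm, max_le hx.2 hy.1.2⟩

theorem RigidSlopes.tonelliPartialRegularity {a b : ℝ} {u : ℝ → ℝ} (hab : a < b)
    (hQ : RigidSlopes a b u) (hu : AbsolutelyContinuousOnInterval u a b) :
    TonelliPartialRegularity a b u := by
  have hcont : ContinuousOn u (Icc a b) := by
    have := hu.continuousOn
    rwa [uIcc_of_le hab.le] at this
  set m : ℝ × ℝ → EReal := fun z => ((slope u z.1 z.2 : ℝ) : EReal) with hm
  have hne : ∀ x ∈ Icc a b, (𝓝[Icc a b \ {x}] x).NeBot := by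
    intro x hx
    have := (uniqueDiffOn_Icc hab x hx).accPt
    rwa [accPt_principal_iff_nhdsWithin] at this
  have hcl : (fun x : ℝ => (x, x)) '' Icc a b ⊆ closure (chords a b) := by
    rintro _ ⟨x, hx, rfl⟩
    have := hne x hx
    exact mem_closure_iff_nhdsWithin_neBot.2 (tendsto_min_max_chords hx).neBot
  have hlim : ∀ z ∈ (fun x : ℝ => (x, x)) '' Icc a b,
      ∃ d, Tendsto m (𝓝[chords a b] z) (𝓝 d) := by
    rintro _ ⟨x, -, rfl⟩
    exact hQ.exists_tendsto hcont x
  set d : ℝ → EReal := fun x => extendFrom (chords a b) m (x, x) with hd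
  have hdc : ContinuousOn d (Icc a b) :=
    (continuousOn_extendFrom hcl hlim).comp (by fun_prop) (mapsTo_image _ _)
  have hder : ∀ x ∈ Icc a b, HasExtDerivAt a b u (d x) x := by
    intro x hx
    have h := (tendsto_extendFrom (hlim (x, x) (mem_image_of_mem _ hx))).comp
      (tendsto_min_max_chords hx)
    refine h.congr fun y => ?_
    simp only [hm, Function.comp]
    rcases le_total x y with hxy | hxy
    · simp [hxy, slope_def_field]
    · rw [min_eq_right hxy, max_eq_left hxy, slope_comm, slope_def_field]
  have huniq : ∀ x ∈ Icc a b, ∀ c, HasExtDerivAt a b u c x → d x = c := by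
    intro x hx c hc
    have := hne x hx
    exact tendsto_nhds_unique (hder x hx) hc
  have hdiff : ∀ x ∈ Icc a b, x ∈ diffSet a b u ↔ d x ≠ ⊥ ∧ d x ≠ ⊤ := by
    intro x hx
    constructor
    · rintro ⟨-, hxd⟩
      have h1 := hasDerivWithinAt_iff_tendsto_slope.1 hxd.hasDerivWithinAt
      have h2 : HasExtDerivAt a b u (derivWithin u (Icc a b) x : ℝ) x := by
        refine ((continuous_coe_real_ereal.tendsto _).comp h1).congr fun y => ?_
        simp [slope_def_field]
      rw [huniq x hx _ h2]
      exact ⟨EReal.coe_ne_bot _, EReal.coe_ne_top _⟩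
    · rintro ⟨h1, h2⟩
      refine ⟨hx, ?_⟩
      have h3 := hder x hx
      rw [← EReal.coe_toReal h2 h1] at h3
      refine HasDerivWithinAt.differentiableWithinAt (f' := (d x).toReal)
        (hasDerivWithinAt_iff_tendsto_slope.2 ?_)
      refine (EReal.tendsto_coe.1 h3).congr fun y => ?_
      simp [slope_def_field]
  refine ⟨hu, ?_, ?_, d, hder, hdc⟩
  · have hset : ((↑) ⁻¹' diffSet a b u : Set (Icc a b)) =
        (fun x : Icc a b => d x) ⁻¹' ({⊥}ᶜ ∩ {⊤}ᶜ) := by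
      ext ⟨x, hx⟩
      simpa using hdiff x hx
    rw [hset]
    exact (isOpen_compl_singleton.inter isOpen_compl_singleton).preimage
      (continuousOn_iff_continuous_domRestrict.1 hdc)
  · ext x
    constructor
    · rintro ⟨hx, hxn⟩
      refine ⟨hx, ?_⟩
      rw [hdiff x hx, not_and_or, not_not, not_not] at hxn
      rcases hxn with h | h
      · left; rw [← h]; exact hder x hx
      · right; rw [← h]; exact hder x hx
    · rintro ⟨hx, h⟩
      refine ⟨hx, fun hxd => ?_⟩
      rw [hdiff x hx] at hxd
      rcases h with h | h
      · exact hxd.1 (huniq x hx _ h)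
      · exact hxd.2 (huniq x hx _ h)

/-! ### The clipped chord -/

/-- The function `v` clipped to the strip between the obstacles `f` and `g`. -/
def clip (f g v : ℝ → ℝ) (x : ℝ) : ℝ := max (f x) (min (v x) (g x))

lemma le_clip (f g v : ℝ → ℝ) (x : ℝ) : f x ≤ clip f g v x := le_max_left _ _

lemma clip_le {f g : ℝ → ℝ} {x : ℝ} (h : f x ≤ g x) (v : ℝ → ℝ) : clip f g v x ≤ g x :=
  max_le h (min_le_right _ _)

lemma clip_eq {f g v : ℝ → ℝ} {x : ℝ} (h₁ : f x ≤ v x) (h₂ : v x ≤ g x) : clip f g v x = v x := by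
  rw [clip, min_eq_left h₂, max_eq_right h₁]

/-- Clipping does not increase the distance to a function inside the strip. -/
lemma abs_clip_sub_le {f g v : ℝ → ℝ} {x y : ℝ} (h₁ : f x ≤ y) (h₂ : y ≤ g x) :
    |clip f g v x - y| ≤ |v x - y| := by
  have h : y = max (f x) (min y (g x)) := by rw [min_eq_left h₂, max_eq_right h₁]
  calc |clip f g v x - y| = |max (f x) (min (v x) (g x)) - max (f x) (min y (g x))| := by
        rw [← h]; rfl
    _ ≤ max |f x - f x| |min (v x) (g x) - min y (g x)| := abs_max_sub_max_le_max _ _ _ _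
    _ ≤ max |f x - f x| (max |v x - y| |g x - g x|) := by
        gcongr; exact abs_min_sub_min_le_max _ _ _ _
    _ = |v x - y| := by simp

lemma lipschitzOnWith_clip {f g v : ℝ → ℝ} {S : Set ℝ} {Kf Kg Kv : ℝ≥0}
    (hf : LipschitzOnWith Kf f S) (hg : LipschitzOnWith Kg g S) (hv : LipschitzOnWith Kv v S) :
    LipschitzOnWith (max Kf (max Kv Kg)) (clip f g v) S := by
  refine LipschitzOnWith.of_dist_le_mul fun x hx y hy => ?_
  have h1 := hf.dist_le_mul x hx y hy
  have h2 := hg.dist_le_mul x hx y hy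
  have h3 := hv.dist_le_mul x hx y hy
  simp only [Real.dist_eq] at h1 h2 h3 ⊢
  calc |clip f g v x - clip f g v y|
      ≤ max |f x - f y| |min (v x) (g x) - min (v y) (g y)| := abs_max_sub_max_le_max _ _ _ _
    _ ≤ max |f x - f y| (max |v x - v y| |g x - g y|) := by
        gcongr; exact abs_min_sub_min_le_max _ _ _ _
    _ ≤ max (Kf * |x - y|) (max (Kv * |x - y|) (Kg * |x - y|)) := by gcongr
    _ = _ := by
        push_cast
        rw [max_mul_of_nonneg _ _ (abs_nonneg _), max_mul_of_nonneg _ _ (abs_nonneg _)]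

lemma C1Holder.exists_lipschitzOnWith {a b : ℝ} {σ : ℝ≥0} {h : ℝ → ℝ} (hh : C1Holder a b σ h) :
    ∃ K, LipschitzOnWith K h (Icc a b) :=
  hh.1.exists_lipschitzOnWith (by decide) (convex_Icc _ _) isCompact_Icc

lemma C1Holder.differentiableAt {a b : ℝ} {σ : ℝ≥0} {h : ℝ → ℝ} (hh : C1Holder a b σ h) {x : ℝ}
    (hx : x ∈ Ioo a b) : DifferentiableAt ℝ h x :=
  (hh.1.differentiableOn (by decide) x (Ioo_subset_Icc_self hx)).differentiableAt
    (Icc_mem_nhds hx.1 hx.2)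

lemma C1Holder.exists_abs_deriv_sub_le {a b : ℝ} {σ : ℝ≥0} {h : ℝ → ℝ} (hh : C1Holder a b σ h) :
    ∃ C : ℝ, 0 ≤ C ∧ ∀ x ∈ Ioo a b, ∀ y ∈ Ioo a b, ∀ r, |x - y| ≤ r →
      |deriv h x - deriv h y| ≤ C * r ^ (σ : ℝ) := by
  obtain ⟨C, hC⟩ := hh.2
  refine ⟨C, C.2, fun x hx y hy r hr => ?_⟩
  have := hC.dist_le_of_le (Ioo_subset_Icc_self hx) (Ioo_subset_Icc_self hy) (d := r) hr
  rwa [derivWithin_of_mem_nhds (Icc_mem_nhds hx.1 hx.2),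
    derivWithin_of_mem_nhds (Icc_mem_nhds hy.1 hy.2), Real.dist_eq] at this

/-- Where an obstacle `f` lies above the affine function `v` of slope `p`, although it does not at
the ends of the interval `[s,t]`, its derivative is close to `p`: by the mean value theorem `f'`
exceeds `p` at a point to the left and is below `p` at a point to the right. -/
lemma abs_deriv_sub_slope_le {a b s t p E x : ℝ} {f v : ℝ → ℝ} (has : a ≤ s) (htb : t ≤ b)
    (hfc : ContinuousOn f (Icc a b)) (hfd : ∀ x ∈ Ioo a b, DifferentiableAt ℝ f x)
    (hE : ∀ y ∈ Ioo s t, ∀ z ∈ Ioo s t, |deriv f y - deriv f z| ≤ E)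
    (hv : ∀ y z, v z - v y = p * (z - y)) (hs : f s ≤ v s) (ht : f t ≤ v t)
    (hx : x ∈ Ioo s t) (hxf : v x ≤ f x) : |deriv f x - p| ≤ E := by
  obtain ⟨c, hc, hc'⟩ := exists_deriv_eq_slope f hx.1
    (hfc.mono (Icc_subset_Icc has (hx.2.le.trans htb)))
    fun y hy => (hfd y ⟨has.trans_lt hy.1, (hy.2.trans hx.2).trans_le htb⟩).differentiableWithinAt
  obtain ⟨d, hd, hd'⟩ := exists_deriv_eq_slope f hx.2
    (hfc.mono (Icc_subset_Icc (has.trans hx.1.le) htb))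
    fun y hy => (hfd y ⟨has.trans_lt (hx.1.trans hy.1), hy.2.trans_le htb⟩).differentiableWithinAt
  have h1 : p ≤ deriv f c := by
    rw [hc', le_div_iff₀ (sub_pos.2 hx.1), ← hv]; linarith
  have h2 : deriv f d ≤ p := by
    rw [hd', div_le_iff₀ (sub_pos.2 hx.2), ← hv]; linarith
  have h3 := abs_le.1 (hE x hx c ⟨hc.1, hc.2.trans hx.2⟩)
  have h4 := abs_le.1 (hE x hx d ⟨hx.1.trans hd.1, hd.2⟩)
  exact abs_le.2 ⟨by linarith, by linarith⟩

/-- The derivative of a clipped chord is uniformly close to the slope of the chord. -/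
lemma abs_deriv_clip_sub_le {a b s t p E x : ℝ} {f g v : ℝ → ℝ} (has : a ≤ s) (htb : t ≤ b)
    (hfc : ContinuousOn f (Icc a b)) (hfd : ∀ x ∈ Ioo a b, DifferentiableAt ℝ f x)
    (hgc : ContinuousOn g (Icc a b)) (hgd : ∀ x ∈ Ioo a b, DifferentiableAt ℝ g x)
    (hEf : ∀ y ∈ Ioo s t, ∀ z ∈ Ioo s t, |deriv f y - deriv f z| ≤ E)
    (hEg : ∀ y ∈ Ioo s t, ∀ z ∈ Ioo s t, |deriv g y - deriv g z| ≤ E)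
    (hv : ∀ y z, v z - v y = p * (z - y)) (hfg : ∀ x ∈ Icc a b, f x < g x)
    (hfs : f s ≤ v s) (hft : f t ≤ v t) (hgs : v s ≤ g s) (hgt : v t ≤ g t)
    (hx : x ∈ Ioo s t) (hd : DifferentiableAt ℝ (clip f g v) x) :
    |deriv (clip f g v) x - p| ≤ E := by
  have hxab : x ∈ Ioo a b := ⟨has.trans_lt hx.1, hx.2.trans_le htb⟩
  have hfx : ContinuousAt f x := (hfd x hxab).continuousAt
  have hgx : ContinuousAt g x := (hgd x hxab).continuousAt
  have hvd : ∀ y, HasDerivAt v p y := by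
    have : v = fun y => v 0 + p * y := by
      ext y; linarith [hv 0 y]
    intro y
    rw [this]
    simpa using ((hasDerivAt_id y).const_mul p).const_add (v 0)
  have hvx : ContinuousAt v x := (hvd x).continuousAt
  have hE0 : 0 ≤ E := (abs_nonneg _).trans (hEf x hx x hx)
  have hfgx := hfg x (Ioo_subset_Icc_self hxab)
  have hsub : HasDerivAt (fun y => clip f g v y - v y) (deriv (clip f g v) x - p) x :=
    hd.hasDerivAt.sub (hvd x)
  rcases lt_trichotomy (v x) (f x) with h | h | h
  · -- below the lower obstacle the clipped chord is `f`
    have heq : clip f g v =ᶠ[𝓝 x] f := by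
      filter_upwards [hvx.eventually_lt hfx h] with y hy
      exact max_eq_left ((min_le_left _ _).trans hy.le)
    rw [heq.deriv_eq]
    exact abs_deriv_sub_slope_le has htb hfc hfd hEf hv hfs hft hx h.le
  · -- at a contact point `clip f g v - v` has a local minimum
    have hmin : IsLocalMin (fun y => clip f g v y - v y) x := by
      filter_upwards [hvx.eventually_lt hgx (h ▸ hfgx)] with y hy
      rw [clip_eq h.ge (h ▸ hfgx.le), sub_self, sub_nonneg, clip, min_eq_left hy.le]
      exact le_max_right _ _
    rw [hmin.hasDerivAt_eq_zero hsub, abs_zero]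
    exact hE0
  rcases lt_trichotomy (v x) (g x) with h' | h' | h'
  · have heq : clip f g v =ᶠ[𝓝 x] v := by
      filter_upwards [hfx.eventually_lt hvx h, hvx.eventually_lt hgx h'] with y hy hy'
      exact clip_eq hy.le hy'.le
    rw [heq.deriv_eq, (hvd x).deriv, sub_self, abs_zero]
    exact hE0
  · have hmax : IsLocalMax (fun y => clip f g v y - v y) x := by
      filter_upwards [hfx.eventually_lt hvx h] with y hy
      rw [clip_eq h.le h'.le, sub_self, sub_nonpos, clip]
      exact max_le hy.le (min_le_left _ _)
    rw [hmax.hasDerivAt_eq_zero hsub, abs_zero]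
    exact hE0
  · have hab' : ∀ᶠ y in 𝓝 x, y ∈ Ioo a b := Ioo_mem_nhds hxab.1 hxab.2
    have heq : clip f g v =ᶠ[𝓝 x] g := by
      filter_upwards [hgx.eventually_lt hvx h', hab'] with y hy hyab
      rw [clip, min_eq_right hy.le]
      exact max_eq_right (hfg y (Ioo_subset_Icc_self hyab)).le
    rw [heq.deriv_eq]
    -- the upper obstacle is treated as a lower one by reflection
    have h := abs_deriv_sub_slope_le (f := fun y => -g y) (v := fun y => -v y) (p := -p) (E := E)
      has htb hgc.neg (fun y hy => (hgd y hy).neg)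
      (fun y hy z hz => by
        rw [deriv.fun_neg, deriv.fun_neg, neg_sub_neg, abs_sub_comm]; exact hEg y hy z hz)
      (fun y z => by have := hv y z; linarith) (neg_le_neg hgs) (neg_le_neg hgt) hx
      (neg_le_neg h'.le)
    rwa [deriv.fun_neg, neg_sub_neg, abs_sub_comm] at h

/-! ### The Lagrangian in the last variable -/

lemma GloballyElliptic.hasDerivAt {a b : ℝ} {L : ℝ × ℝ × ℝ → ℝ} (hL : GloballyElliptic a b L)
    {x : ℝ} (hx : x ∈ Icc a b) (u v : ℝ) :
    HasDerivAt (fun v => L (x, u, v)) (partialV L (x, u, v)) v :=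
  (hL.differentiable x hx u v).hasDerivAt

lemma GloballyElliptic.hasDerivAt_partialV {a b : ℝ} {L : ℝ × ℝ × ℝ → ℝ}
    (hL : GloballyElliptic a b L) {x : ℝ} (hx : x ∈ Icc a b) (u v : ℝ) :
    HasDerivAt (fun v => partialV L (x, u, v)) (partialV (partialV L) (x, u, v)) v :=
  (hL.differentiable_partialV x hx u v).hasDerivAt

/-- A function whose second derivative is at least `μ` lies above its tangent parabolas. -/
lemma GloballyElliptic.tangent_le {a b μ : ℝ} {L : ℝ × ℝ × ℝ → ℝ} (hL : GloballyElliptic a b L)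
    (hμ : ∀ p ∈ domain a b, μ ≤ partialV (partialV L) p) {x : ℝ} (hx : x ∈ Icc a b) (u p ξ : ℝ) :
    L (x, u, p) + partialV L (x, u, p) * (ξ - p) + μ / 2 * (ξ - p) ^ 2 ≤ L (x, u, ξ) := by
  set ψ : ℝ → ℝ := fun v =>
    L (x, u, v) - partialV L (x, u, p) * (v - p) - μ / 2 * (v - p) ^ 2 with hψ
  have hd : ∀ v, HasDerivAt ψ
      (partialV L (x, u, v) - partialV L (x, u, p) - μ * (v - p)) v := by
    intro v
    have h := ((hL.hasDerivAt hx u v).sub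
      (((hasDerivAt_id v).sub_const p).const_mul (partialV L (x, u, p)))).sub
      ((((hasDerivAt_id v).sub_const p).pow 2).const_mul (μ / 2))
    refine h.congr_deriv ?_
    simp; ring
  have hd2 : ∀ v, HasDerivAt (deriv ψ) (partialV (partialV L) (x, u, v) - μ) v := by
    intro v
    rw [show deriv ψ = fun v => partialV L (x, u, v) - partialV L (x, u, p) - μ * (v - p) from
      funext fun v => (hd v).deriv]
    have h := ((hL.hasDerivAt_partialV hx u v).sub_const (partialV L (x, u, p))).sub
      (((hasDerivAt_id v).sub_const p).const_mul μ)
    refine h.congr_deriv ?_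
    simp
  have hmono : Monotone (deriv ψ) := monotone_of_deriv_nonneg (fun v => (hd2 v).differentiableAt)
    fun v => by rw [(hd2 v).deriv]; exact sub_nonneg.2 (hμ _ ⟨hx, mem_univ _⟩)
  have hconv : ConvexOn ℝ univ ψ :=
    hmono.convexOn_univ_of_deriv fun v => (hd v).differentiableAt
  have hp0 : HasDerivAt ψ 0 p := (hd p).congr_deriv (by simp)
  have hmin : ψ p ≤ ψ ξ := by
    have := hconv.isMinOn_of_rightDeriv_eq_zero (x := p) (by simp)
      (by rw [(hp0.hasDerivWithinAt).derivWithin (uniqueDiffWithinAt_Ioi p)])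
    exact this (mem_univ ξ)
  simp only [hψ, sub_self] at hmin
  linarith

/-- On bounded sets `L`, `L_v` and `L_vv` are bounded; for `L_v` this follows from the convexity of
`L` in `v`. -/
lemma exists_bound {a b : ℝ} {L : ℝ × ℝ × ℝ → ℝ} (hL : ContinuousOn L (domain a b))
    (hE : GloballyElliptic a b L) (R N : ℝ) :
    ∃ K : ℝ, 0 ≤ K ∧ ∀ x ∈ Icc a b, ∀ u v : ℝ, |u| ≤ R → |v| ≤ N →
      |L (x, u, v)| ≤ K ∧ |partialV L (x, u, v)| ≤ K ∧ |partialV (partialV L) (x, u, v)| ≤ K := by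
  set G : Set (ℝ × ℝ × ℝ) := Icc a b ×ˢ (Icc (-R) R ×ˢ Icc (-(N + 1)) (N + 1)) with hG
  have hGc : IsCompact G := isCompact_Icc.prod (isCompact_Icc.prod isCompact_Icc)
  have hGd : G ⊆ domain a b := prod_mono_right (subset_univ _)
  obtain ⟨K₀, hK₀⟩ := hGc.exists_bound_of_continuousOn (hL.mono hGd)
  obtain ⟨K₂, hK₂⟩ := hGc.exists_bound_of_continuousOn (hE.continuousOn_partialVV.mono hGd)
  obtain ⟨μ, hμ0, hμ⟩ := hE.bounded_below
  have hmem : ∀ x ∈ Icc a b, ∀ u v : ℝ, |u| ≤ R → |v| ≤ N + 1 → (x, u, v) ∈ G :=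
    fun x hx u v hu hv => ⟨hx, abs_le.1 hu, abs_le.1 hv⟩
  refine ⟨2 * |K₀| + |K₂|, by positivity, fun x hx u v hu hv => ?_⟩
  have h0 := hK₀ _ (hmem x hx u v hu (by linarith))
  have h2 := hK₂ _ (hmem x hx u v hu (by linarith))
  have hv' := abs_le.1 hv
  have h3 := hK₀ _ (hmem x hx u (v + 1) hu (abs_le.2 ⟨by linarith, by linarith⟩))
  have h4 := hK₀ _ (hmem x hx u (v - 1) hu (abs_le.2 ⟨by linarith, by linarith⟩))
  have t1 := hE.tangent_le hμ hx u v (v + 1)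
  have t2 := hE.tangent_le hμ hx u v (v - 1)
  simp only [Real.norm_eq_abs, abs_le] at h0 h2 h3 h4
  have k0 := le_abs_self K₀
  have k2 := le_abs_self K₂
  have k0' := abs_nonneg K₀
  have k2' := abs_nonneg K₂
  refine ⟨abs_le.2 ⟨by linarith, by linarith⟩, abs_le.2 ⟨?_, ?_⟩,
    abs_le.2 ⟨by linarith, by linarith⟩⟩
  · nlinarith
  · nlinarith

/-- If `L` differs at two points `(x, u)` by at most `η²` for the two arguments `p` and `p + η`,
then `L_v(·, ·, p)` differs by at most a constant times `η`: a difference quotient of step `η`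
approximates `L_v` up to `K η`, where `K` bounds `L_vv`. -/
lemma GloballyElliptic.abs_partialV_sub_le {a b K p η : ℝ} {L : ℝ × ℝ × ℝ → ℝ}
    (hE : GloballyElliptic a b L) (hη : 0 < η) {x u y w : ℝ} (hx : x ∈ Icc a b) (hy : y ∈ Icc a b)
    (hKx : ∀ v ∈ Icc p (p + η), |partialV (partialV L) (x, u, v)| ≤ K)
    (hKy : ∀ v ∈ Icc p (p + η), |partialV (partialV L) (y, w, v)| ≤ K)
    (h₀ : |L (x, u, p) - L (y, w, p)| ≤ η ^ 2)
    (h₁ : |L (x, u, p + η) - L (y, w, p + η)| ≤ η ^ 2) :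
    |partialV L (x, u, p) - partialV L (y, w, p)| ≤ (2 + 2 * K) * η := by
  have key : ∀ z ∈ Icc a b, ∀ q, (∀ v ∈ Icc p (p + η), |partialV (partialV L) (z, q, v)| ≤ K) →
      |L (z, q, p + η) - L (z, q, p) - partialV L (z, q, p) * η| ≤ K * η ^ 2 := by
    intro z hz q hK
    obtain ⟨c, hc, hc'⟩ := exists_hasDerivAt_eq_slope (fun v => L (z, q, v))
      (fun v => partialV L (z, q, v)) (lt_add_of_pos_right p hη)
      (hE.differentiable z hz q).continuous.continuousOn fun v _ => hE.hasDerivAt hz q v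
    have hlip := (convex_Icc p (p + η)).norm_image_sub_le_of_norm_hasDerivWithin_le
      (f := fun v => partialV L (z, q, v)) (fun v _ =>
        (hE.hasDerivAt_partialV hz q v).hasDerivWithinAt) hK
      (left_mem_Icc.2 (by linarith)) (Ioo_subset_Icc_self hc)
    have hK0 : 0 ≤ K := (abs_nonneg _).trans (hK p (left_mem_Icc.2 (by linarith)))
    rw [add_sub_cancel_left, eq_div_iff hη.ne'] at hc'
    rw [← hc', ← sub_mul, abs_mul, abs_of_pos hη, sq, ← mul_assoc]
    simp only [Real.norm_eq_abs] at hlip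
    gcongr
    refine hlip.trans ?_
    gcongr
    rw [abs_of_nonneg (by linarith [hc.1])]
    linarith [hc.2]
  have e1 := abs_le.1 (key x hx u hKx)
  have e2 := abs_le.1 (key y hy w hKy)
  rw [abs_le] at h₀ h₁
  refine le_of_mul_le_mul_right ?_ hη
  rw [← abs_of_pos hη, ← abs_mul, abs_of_pos hη, abs_le]
  constructor <;> nlinarith

lemma GloballyElliptic.abs_sub_le {a b K N : ℝ} {L : ℝ × ℝ × ℝ → ℝ}
    (hE : GloballyElliptic a b L) {x u : ℝ} (hx : x ∈ Icc a b)
    (hK : ∀ v, |v| ≤ N → |partialV L (x, u, v)| ≤ K) {v w : ℝ} (hv : |v| ≤ N) (hw : |w| ≤ N) :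
    |L (x, u, w) - L (x, u, v)| ≤ K * |w - v| :=
  (convex_Icc (-N) N).norm_image_sub_le_of_norm_hasDerivWithin_le
    (f := fun v => L (x, u, v)) (fun v _ => (hE.hasDerivAt hx u v).hasDerivWithinAt)
    (fun v hv => hK v (abs_le.2 hv)) (abs_le.1 hv) (abs_le.1 hw)

/-- Along functions with values in a bounded set the Lagrangian is bounded below. -/
lemma exists_lower_bound {a b : ℝ} {L : ℝ × ℝ × ℝ → ℝ} (hL : ContinuousOn L (domain a b))
    (hE : GloballyElliptic a b L) (R : ℝ) :
    ∃ m : ℝ, ∀ x ∈ Icc a b, ∀ u v : ℝ, |u| ≤ R → m ≤ L (x, u, v) := by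
  obtain ⟨μ, hμ0, hμ⟩ := hE.bounded_below
  obtain ⟨K, hK0, hK⟩ := exists_bound hL hE R 0
  refine ⟨-K - K ^ 2 / (2 * μ), fun x hx u v hu => ?_⟩
  obtain ⟨h1, h2, -⟩ := hK x hx u 0 hu (by simp)
  have t := hE.tangent_le hμ hx u 0 v
  set l := partialV L (x, u, 0)
  have h3 : -(l ^ 2 / (2 * μ)) ≤ l * (v - 0) + μ / 2 * (v - 0) ^ 2 := by
    have : l * (v - 0) + μ / 2 * (v - 0) ^ 2 + l ^ 2 / (2 * μ) = (μ * v + l) ^ 2 / (2 * μ) := by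
      field_simp; ring
    have h4 : 0 ≤ (μ * v + l) ^ 2 / (2 * μ) := by positivity
    linarith
  have h5 : l ^ 2 / (2 * μ) ≤ K ^ 2 / (2 * μ) := by
    gcongr 1; exact sq_le_sq' (abs_le.1 h2).1 (abs_le.1 h2).2
  linarith [(abs_le.1 h1).1]

/-! ### Energies and minimality on subintervals -/

lemma aestronglyMeasurable_lagrangian {a b : ℝ} {L : ℝ × ℝ × ℝ → ℝ}
    (hL : ContinuousOn L (domain a b)) {u φ : ℝ → ℝ} (hu : ContinuousOn u (Icc a b))
    (hφ : Measurable φ) :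
    AEStronglyMeasurable (fun x => L (x, u x, φ x)) (volume.restrict (Icc a b)) := by
  refine AEMeasurable.aestronglyMeasurable ?_
  rcases lt_or_ge b a with h | h
  · simp [Icc_eq_empty_of_lt h]
  -- extend `L` continuously to all of `ℝ × ℝ × ℝ`
  have hL' : Continuous fun q : ℝ × ℝ × ℝ => L ((projIcc a b h q.1 : ℝ), q.2) :=
    hL.comp_continuous (by fun_prop) fun q => ⟨(projIcc a b h q.1).2, mem_univ _⟩
  have hΦ : AEMeasurable (fun x => (x, u x, φ x)) (volume.restrict (Icc a b)) :=
    aemeasurable_id.prodMk ((hu.aemeasurable measurableSet_Icc).prodMk hφ.aemeasurable)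
  refine (hL'.measurable.comp_aemeasurable hΦ).congr ?_
  filter_upwards [ae_restrict_mem measurableSet_Icc] with x hx
  simp [projIcc_of_mem h hx]

lemma energy_eq_integral {a b : ℝ} {L : ℝ × ℝ × ℝ → ℝ} {u : ℝ → ℝ}
    (h : IntegrableOn (fun x => L (x, u x, deriv u x)) (Icc a b)) :
    energy a b L u = ((∫ x in Icc a b, L (x, u x, deriv u x) : ℝ) : EReal) := by
  have h1 : ∫⁻ x in Icc a b, ENNReal.ofReal (L (x, u x, deriv u x)) ≠ ⊤ :=
    h.lintegral_lt_top.ne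
  have h2 : ∫⁻ x in Icc a b, ENNReal.ofReal (-L (x, u x, deriv u x)) ≠ ⊤ :=
    h.neg.lintegral_lt_top.ne
  rw [energy, integral_eq_lintegral_pos_part_sub_lintegral_neg_part h, EReal.coe_sub,
    EReal.coe_ennreal_toReal h1, EReal.coe_ennreal_toReal h2]

lemma integrableOn_of_energy_le {a b : ℝ} {L : ℝ × ℝ × ℝ → ℝ} {u : ℝ → ℝ} {m r : ℝ}
    (hmeas : AEStronglyMeasurable (fun x => L (x, u x, deriv u x)) (volume.restrict (Icc a b)))
    (hm : ∀ x ∈ Icc a b, m ≤ L (x, u x, deriv u x)) (hr : energy a b L u ≤ r) :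
    IntegrableOn (fun x => L (x, u x, deriv u x)) (Icc a b) := by
  have hneg : ∫⁻ x in Icc a b, ENNReal.ofReal (-L (x, u x, deriv u x)) ≠ ⊤ := by
    refine ne_top_of_le_ne_top (b := ∫⁻ _ in Icc a b, ENNReal.ofReal (-m)) ?_ ?_
    · rw [setLIntegral_const]
      exact ENNReal.mul_ne_top ENNReal.ofReal_ne_top (by simp)
    · refine setLIntegral_mono' measurableSet_Icc fun x hx => ?_
      exact ENNReal.ofReal_le_ofReal (neg_le_neg (hm x hx))
  have hpos : ∫⁻ x in Icc a b, ENNReal.ofReal (L (x, u x, deriv u x)) ≠ ⊤ := by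
    intro htop
    rw [energy, htop, ← EReal.coe_ennreal_toReal hneg, EReal.coe_ennreal_top,
      EReal.top_sub_coe] at hr
    exact absurd hr (not_le.2 (EReal.coe_lt_top r))
  refine ⟨hmeas, ?_⟩
  have heq : ∀ y : ℝ, ‖y‖ₑ = ENNReal.ofReal y + ENNReal.ofReal (-y) := by
    intro y
    rw [Real.enorm_eq_ofReal_abs]
    rcases le_total 0 y with h | h
    · rw [abs_of_nonneg h, ENNReal.ofReal_of_nonpos (neg_nonpos.2 h), add_zero]
    · rw [abs_of_nonpos h, ENNReal.ofReal_of_nonpos h, zero_add]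
  rw [HasFiniteIntegral]
  simp only [heq]
  rw [lintegral_add_left' hmeas.aemeasurable.ennreal_ofReal]
  exact ENNReal.add_lt_top.2 ⟨hpos.lt_top, hneg.lt_top⟩

lemma ae_restrict_Icc_mem_Ioo (s t : ℝ) : ∀ᵐ x ∂volume.restrict (Icc s t), x ∈ Ioo s t := by
  rw [← restrict_Ioo_eq_restrict_Icc]; exact ae_restrict_mem measurableSet_Ioo

lemma integrableOn_lagrangian_of_lipschitzOnWith {a b s t : ℝ} {L : ℝ × ℝ × ℝ → ℝ}
    (hL : ContinuousOn L (domain a b)) (has : a ≤ s) (htb : t ≤ b)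
    {w : ℝ → ℝ} {k : ℝ≥0} (hw : LipschitzOnWith k w (Icc s t)) :
    IntegrableOn (fun x => L (x, w x, deriv w x)) (Icc s t) := by
  obtain ⟨R, hR⟩ := isCompact_Icc.exists_bound_of_continuousOn hw.continuousOn
  set G : Set (ℝ × ℝ × ℝ) := Icc s t ×ˢ (Icc (-R) R ×ˢ Icc (-(k : ℝ)) k)
  have hGd : domain s t ⊆ domain a b := prod_mono_left (Icc_subset_Icc has htb)
  obtain ⟨K, hK⟩ := (isCompact_Icc.prod (isCompact_Icc.prod isCompact_Icc) :
    IsCompact G).exists_bound_of_continuousOn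
      (hL.mono ((prod_mono_right (subset_univ _)).trans hGd))
  refine Integrable.of_bound (aestronglyMeasurable_lagrangian (hL.mono hGd)
    hw.continuousOn (measurable_deriv w)) K ?_
  filter_upwards [ae_restrict_Icc_mem_Ioo s t] with x hx
  exact hK _ ⟨Ioo_subset_Icc_self hx, abs_le.1 (hR x (Ioo_subset_Icc_self hx)),
    abs_le.1 (norm_deriv_le_of_lipschitzOn (Icc_mem_nhds hx.1 hx.2) hw)⟩

lemma _root_.AbsolutelyContinuousOnInterval.mono_Icc {a b s t : ℝ} {u : ℝ → ℝ}
    (hu : AbsolutelyContinuousOnInterval u a b) (has : a ≤ s) (hst : s ≤ t) (htb : t ≤ b) :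
    AbsolutelyContinuousOnInterval u s t := by
  refine hu.mono ?_
  rw [uIcc_of_le hst, uIcc_of_le (has.trans (hst.trans htb))]
  exact Icc_subset_Icc has htb

lemma setIntegral_Icc_deriv_eq_sub {u : ℝ → ℝ} {s t : ℝ} (hst : s ≤ t)
    (hu : AbsolutelyContinuousOnInterval u s t) :
    ∫ x in Icc s t, deriv u x = u t - u s := by
  rw [integral_Icc_eq_integral_Ioc, ← intervalIntegral.integral_of_le hst, hu.integral_deriv_eq_sub]

/-- An absolutely continuous function may be replaced on a subinterval by another one with the same
end values. The modification is obtained by integrating the modified derivative. -/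
lemma exists_glue {a b s t : ℝ} {u w : ℝ → ℝ} (has : a ≤ s) (hst : s ≤ t) (htb : t ≤ b)
    (hu : AbsolutelyContinuousOnInterval u a b) (hw : AbsolutelyContinuousOnInterval w s t)
    (hs : w s = u s) (ht : w t = u t) :
    ∃ U : ℝ → ℝ, AbsolutelyContinuousOnInterval U a b ∧ (∀ x ∈ Icc s t, U x = w x) ∧
      ∀ x ∈ Icc a b, x ∉ Ioo s t → U x = u x := by
  classical
  have hsub : ∀ {c d : ℝ}, a ≤ c → c ≤ d → d ≤ b → AbsolutelyContinuousOnInterval u c d :=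
    fun hc hcd hd => hu.mono_Icc hc hcd hd
  set φ : ℝ → ℝ := fun x => if x ∈ Ioc s t then deriv w x else deriv u x with hφ
  have hφu : ∀ c d, c ≤ d → (∀ x ∈ Ioc c d, x ∉ Ioc s t) → EqOn φ (deriv u) (uIoc c d) := by
    intro c d hcd h x hx
    rw [uIoc_of_le hcd] at hx
    exact if_neg (h x hx)
  have hφw : ∀ x ∈ Icc s t, EqOn φ (deriv w) (uIoc s x) := by
    intro x hx y hy
    rw [uIoc_of_le hx.1] at hy
    exact if_pos ⟨hy.1, hy.2.trans hx.2⟩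
  have hleft : ∀ x ∈ Icc a s, EqOn φ (deriv u) (uIoc a x) := fun x hx =>
    hφu a x hx.1 fun y hy hy' => (hy.2.trans hx.2).not_gt hy'.1
  have hright : ∀ x ∈ Icc t b, EqOn φ (deriv u) (uIoc t x) := fun x hx =>
    hφu t x hx.1 fun y hy hy' => hy.1.not_ge hy'.2
  have i1 : IntervalIntegrable φ volume a s :=
    (hsub le_rfl has (hst.trans htb)).intervalIntegrable_deriv.congr (hleft s ⟨has, le_rfl⟩).symm
  have i2 : IntervalIntegrable φ volume s t :=
    hw.intervalIntegrable_deriv.congr (hφw t ⟨hst, le_rfl⟩).symm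
  have i3 : IntervalIntegrable φ volume t b :=
    (hsub (has.trans hst) htb le_rfl).intervalIntegrable_deriv.congr
      (hright b ⟨htb, le_rfl⟩).symm
  have hleftv : ∀ x ∈ Icc a s, ∫ y in a..x, φ y = u x - u a := by
    intro x hx
    rw [intervalIntegral.integral_congr_ae (.of_forall fun y hy => hleft x hx hy),
      (hsub le_rfl hx.1 (hx.2.trans (hst.trans htb))).integral_deriv_eq_sub]
  have hmidv : ∀ x ∈ Icc s t, ∫ y in a..x, φ y = w x - u a := by
    intro x hx
    have hwx : AbsolutelyContinuousOnInterval w s x := hw.mono_Icc le_rfl hx.1 hx.2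
    have i2' : IntervalIntegrable φ volume s x :=
      hwx.intervalIntegrable_deriv.congr (hφw x hx).symm
    rw [← intervalIntegral.integral_add_adjacent_intervals i1 i2', hleftv s ⟨has, le_rfl⟩,
      intervalIntegral.integral_congr_ae (.of_forall fun y hy => hφw x hx hy),
      hwx.integral_deriv_eq_sub, hs]
    ring
  have hrightv : ∀ x ∈ Icc t b, ∫ y in a..x, φ y = u x - u a := by
    intro x hx
    have hux := hsub (has.trans hst) hx.1 hx.2
    have i3' : IntervalIntegrable φ volume t x :=
      hux.intervalIntegrable_deriv.congr (hright x hx).symm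
    rw [← intervalIntegral.integral_add_adjacent_intervals (i1.trans i2) i3',
      hmidv t ⟨hst, le_rfl⟩,
      intervalIntegral.integral_congr_ae (.of_forall fun y hy => hright x hx hy),
      hux.integral_deriv_eq_sub, ht]
    ring
  have hconst : AbsolutelyContinuousOnInterval (fun _ : ℝ => u a) a b :=
    ((LipschitzWith.const (u a)).lipschitzOnWith (s := uIcc a b)).absolutelyContinuousOnInterval
  refine ⟨fun x => u a + ∫ y in a..x, φ y, hconst.add
    (((i1.trans i2).trans i3).absolutelyContinuousOnInterval_intervalIntegral left_mem_uIcc),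
    fun x hx => ?_, fun x hx hxst => ?_⟩
  · simp only [hmidv x hx, add_sub_cancel]
  · simp only
    rcases le_or_gt x s with h | h
    · rw [hleftv x ⟨hx.1, h⟩, add_sub_cancel]
    · have : t ≤ x := by
        by_contra! hcon
        exact hxst ⟨h, hcon⟩
      rw [hrightv x ⟨this, hx.2⟩, add_sub_cancel]

/-- A solution of finite energy has least energy on every subinterval among the Lipschitz functions
which respect the obstacles there and have the same end values. -/
theorem setIntegral_le_of_mem_solutions {a b A B s t : ℝ} {L : ℝ × ℝ × ℝ → ℝ} {f g u w : ℝ → ℝ}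
    (hL : ContinuousOn L (domain a b)) (hu : u ∈ solutions a b A B L f g)
    (hint : IntegrableOn (fun x => L (x, u x, deriv u x)) (Icc a b))
    (has : a ≤ s) (hst : s < t) (htb : t ≤ b) {k : ℝ≥0} (hw : LipschitzOnWith k w (Icc s t))
    (hws : w s = u s) (hwt : w t = u t) (hfw : ∀ x ∈ Icc s t, f x ≤ w x ∧ w x ≤ g x) :
    ∫ x in Icc s t, L (x, u x, deriv u x) ≤ ∫ x in Icc s t, L (x, w x, deriv w x) := by
  obtain ⟨⟨huac, hua, hub, hfu⟩, hmin⟩ := hu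
  have hwac : AbsolutelyContinuousOnInterval w s t :=
    LipschitzOnWith.absolutelyContinuousOnInterval (K := k) (by rwa [uIcc_of_le hst.le])
  obtain ⟨U, hU, hUw, hUu⟩ := exists_glue has hst.le htb huac hwac hws hwt
  have hss : Icc s t ⊆ Icc a b := Icc_subset_Icc has htb
  have hUadm : U ∈ admissible a b A B f g := by
    refine ⟨hU, ?_, ?_, fun x hx => ?_⟩
    · rw [hUu a ⟨le_rfl, has.trans (hst.le.trans htb)⟩ fun h => has.not_gt h.1, hua]
    · rw [hUu b ⟨has.trans (hst.le.trans htb), le_rfl⟩ fun h => htb.not_gt h.2, hub]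
    · by_cases hxs : x ∈ Icc s t
      · rw [hUw x hxs]; exact hfw x hxs
      · rw [hUu x hx fun h => hxs (Ioo_subset_Icc_self h)]; exact hfu x hx
  -- almost everywhere the derivative of `U` is that of `w` inside `[s,t]` and that of `u` outside
  have hin : ∀ᵐ x ∂volume.restrict (Icc s t),
      L (x, U x, deriv U x) = L (x, w x, deriv w x) := by
    filter_upwards [ae_restrict_Icc_mem_Ioo s t] with x hx
    have : U =ᶠ[𝓝 x] w := by
      filter_upwards [Ioo_mem_nhds hx.1 hx.2] with y hy using hUw y (Ioo_subset_Icc_self hy)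
    rw [this.deriv_eq, this.eq_of_nhds]
  have hout : ∀ᵐ x ∂volume.restrict (Icc a b \ Icc s t),
      L (x, U x, deriv U x) = L (x, u x, deriv u x) := by
    filter_upwards [ae_restrict_mem (measurableSet_Icc.diff measurableSet_Icc),
      ae_mono (Measure.restrict_mono sdiff_subset le_rfl) (ae_restrict_Icc_mem_Ioo a b)]
      with x hx hxab
    have : U =ᶠ[𝓝 x] u := by
      filter_upwards [Ioo_mem_nhds hxab.1 hxab.2, isClosed_Icc.isOpen_compl.mem_nhds hx.2]
        with y hy hy'
      exact hUu y (Ioo_subset_Icc_self hy) fun h => hy' (Ioo_subset_Icc_self h)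
    rw [this.deriv_eq, this.eq_of_nhds]
  have hintw := integrableOn_lagrangian_of_lipschitzOnWith hL has htb hw
  have hintU1 : IntegrableOn (fun x => L (x, U x, deriv U x)) (Icc s t) :=
    hintw.congr (hin.mono fun x hx => hx.symm)
  have hintU2 : IntegrableOn (fun x => L (x, U x, deriv U x)) (Icc a b \ Icc s t) :=
    (hint.mono_set sdiff_subset).congr (hout.mono fun x hx => hx.symm)
  have hintU : IntegrableOn (fun x => L (x, U x, deriv U x)) (Icc a b) := by
    have := hintU1.union hintU2
    rwa [union_sdiff_cancel hss] at this
  have hle := hmin U hUadm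
  rw [energy_eq_integral hint, energy_eq_integral hintU, EReal.coe_le_coe_iff] at hle
  have split : ∀ F : ℝ → ℝ, IntegrableOn F (Icc a b) →
      ∫ x in Icc a b, F x = (∫ x in Icc s t, F x) + ∫ x in Icc a b \ Icc s t, F x := by
    intro F hF
    rw [← setIntegral_union disjoint_sdiff_right (measurableSet_Icc.diff measurableSet_Icc)
      (hF.mono_set hss) (hF.mono_set sdiff_subset), union_sdiff_cancel hss]
  rw [split _ hint, split _ hintU, integral_congr_ae hin, integral_congr_ae hout] at hle
  linarith

/-- Solutions have finite energy, as there is a Lipschitz admissible function: the chord joining the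
boundary values, clipped to the strip between the obstacles. -/
theorem integrableOn_of_mem_solutions {a b A B : ℝ} {L : ℝ × ℝ × ℝ → ℝ} {σ : ℝ≥0}
    {f g u : ℝ → ℝ} (hab : a < b) (hL : ContinuousOn L (domain a b)) (hE : GloballyElliptic a b L)
    (hf : C1Holder a b σ f) (hg : C1Holder a b σ g) (hfg : ∀ x ∈ Icc a b, f x < g x)
    (hu : u ∈ solutions a b A B L f g) :
    IntegrableOn (fun x => L (x, u x, deriv u x)) (Icc a b) := by
  obtain ⟨⟨huac, hua, hub, hfu⟩, hmin⟩ := hu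
  have huc : ContinuousOn u (Icc a b) := by
    have := huac.continuousOn; rwa [uIcc_of_le hab.le] at this
  obtain ⟨Kf, hKf⟩ := hf.exists_lipschitzOnWith
  obtain ⟨Kg, hKg⟩ := hg.exists_lipschitzOnWith
  set v : ℝ → ℝ := fun x => A + (B - A) / (b - a) * (x - a) with hv
  have hvL : LipschitzOnWith (Real.nnabs ((B - A) / (b - a))) v (Icc a b) := by
    refine LipschitzOnWith.of_dist_le_mul fun x _ y _ => ?_
    rw [Real.dist_eq, Real.dist_eq, Real.coe_nnabs, ← abs_mul]
    exact le_of_eq (congrArg _ (by simp only [hv]; ring))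
  have hw := lipschitzOnWith_clip hKf hKg hvL
  have hba : b - a ≠ 0 := (sub_pos.2 hab).ne'
  have hva : v a = A := by simp [hv]
  have hvb : v b = B := by simp [hv, hba]
  have hadm : clip f g v ∈ admissible a b A B f g := by
    refine ⟨LipschitzOnWith.absolutelyContinuousOnInterval (by rwa [uIcc_of_le hab.le]),
      ?_, ?_, fun x hx => ⟨le_clip _ _ _ _, clip_le (hfg x hx).le _⟩⟩
    · have := hfu a ⟨le_rfl, hab.le⟩
      rw [hua, ← hva] at this
      rw [clip_eq this.1 this.2, hva]
    · have := hfu b ⟨hab.le, le_rfl⟩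
      rw [hub, ← hvb] at this
      rw [clip_eq this.1 this.2, hvb]
  have hle := hmin _ hadm
  rw [energy_eq_integral (integrableOn_lagrangian_of_lipschitzOnWith hL le_rfl le_rfl hw)] at hle
  obtain ⟨R, hR⟩ := isCompact_Icc.exists_bound_of_continuousOn huc
  obtain ⟨m, hm⟩ := exists_lower_bound hL hE R
  exact integrableOn_of_energy_le (aestronglyMeasurable_lagrangian hL huc (measurable_deriv u))
    (fun x hx => hm x hx _ _ (hR x hx)) hle

/-! ### The mean square deviation of the derivative from a chord slope -/

lemma _root_.AbsolutelyContinuousOnInterval.integrableOn_deriv {u : ℝ → ℝ} {s t : ℝ}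
    (hu : AbsolutelyContinuousOnInterval u s t) (hst : s ≤ t) :
    IntegrableOn (deriv u) (Icc s t) := by
  rw [integrableOn_Icc_iff_integrableOn_Ioc]
  exact (intervalIntegrable_iff_integrableOn_Ioc_of_le hst).1 hu.intervalIntegrable_deriv

/-- The increment of `u - p x` is controlled by the mean square of `u' - p`, with a free parameter
`ε` from `2 |ξ| ≤ ε + ξ² / ε`. -/
lemma abs_increment_sub_le {s t x y p ε : ℝ} {u : ℝ → ℝ}
    (hu : AbsolutelyContinuousOnInterval u s t)
    (hint : IntegrableOn (fun z => (deriv u z - p) ^ 2) (Icc s t))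
    (hsx : s ≤ x) (hxy : x ≤ y) (hyt : y ≤ t) (hε : 0 < ε) :
    |u y - u x - p * (y - x)| ≤
      (ε * (y - x) + ε⁻¹ * ∫ z in Icc s t, (deriv u z - p) ^ 2) / 2 := by
  have hss : Icc x y ⊆ Icc s t := Icc_subset_Icc hsx hyt
  have huxy := hu.mono_Icc hsx hxy hyt
  have hd := huxy.integrableOn_deriv hxy
  have hp : IntegrableOn (fun _ : ℝ => p) (Icc x y) := integrableOn_const (by simp)
  have hε' : IntegrableOn (fun _ : ℝ => ε / 2) (Icc x y) := integrableOn_const (by simp)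
  have hvol : volume.real (Icc x y) = y - x := by
    rw [Measure.real, Real.volume_Icc, ENNReal.toReal_ofReal (by linarith)]
  have heq : ∫ z in Icc x y, (deriv u z - p) = u y - u x - p * (y - x) := by
    rw [integral_sub hd hp, setIntegral_Icc_deriv_eq_sub hxy huxy, setIntegral_const, hvol,
      smul_eq_mul, mul_comm]
  rw [← heq]
  calc |∫ z in Icc x y, (deriv u z - p)|
      ≤ ∫ z in Icc x y, |deriv u z - p| := abs_integral_le_integral_abs
    _ ≤ ∫ z in Icc x y, (ε / 2 + ε⁻¹ / 2 * (deriv u z - p) ^ 2) := by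
        refine setIntegral_mono (hd.sub hp).abs
          (hε'.add ((hint.mono_set hss).const_mul _)) fun z => ?_
        have h1 : 0 ≤ (ε - |deriv u z - p|) ^ 2 / (2 * ε) := by positivity
        have h2 : (ε - |deriv u z - p|) ^ 2 / (2 * ε) =
            ε / 2 + ε⁻¹ / 2 * (deriv u z - p) ^ 2 - |deriv u z - p| := by
          rw [sub_sq, sq_abs]; field_simp; ring
        simp only
        linarith
    _ = ε / 2 * (y - x) + ε⁻¹ / 2 * ∫ z in Icc x y, (deriv u z - p) ^ 2 := by
        rw [integral_add hε' ((hint.mono_set hss).const_mul _), setIntegral_const, hvol,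
          integral_const_mul, smul_eq_mul, mul_comm]
    _ ≤ ε / 2 * (y - x) + ε⁻¹ / 2 * ∫ z in Icc s t, (deriv u z - p) ^ 2 := by
        gcongr
        exact .of_forall fun z => sq_nonneg _
    _ = _ := by ring

/-- The energy comparison behind the regularity theory. Suppose that the energy of `u` on `[s,t]` is
at most that of `w`, that the Lagrangian along `w` exceeds `L(x, u, p)` by at most `Q`, where `p` is
the slope of the chord of `u`, and that `L_v(x, u, p)` differs from a constant `l` by at most `√D`.
Then the mean square of `u' - p` is controlled by `Q` and `D`. This is the tangent parabola
inequality at `p`, the linear term of which integrates to zero after `L_v(x, u, p)` has been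
replaced by `l`. -/
lemma integral_sq_le_of_comparison {a b s t μ p Q D l : ℝ} {L : ℝ × ℝ × ℝ → ℝ} {u w : ℝ → ℝ}
    (hL : ContinuousOn L (domain a b)) (hE : GloballyElliptic a b L) (hμ0 : 0 < μ)
    (hμ : ∀ q ∈ domain a b, μ ≤ partialV (partialV L) q)
    (has : a ≤ s) (hst : s < t) (htb : t ≤ b)
    (hu : AbsolutelyContinuousOnInterval u s t) (hp : u t - u s = p * (t - s))
    (hint : IntegrableOn (fun x => L (x, u x, deriv u x)) (Icc s t))
    (hintw : IntegrableOn (fun x => L (x, w x, deriv w x)) (Icc s t))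
    (hle : ∫ x in Icc s t, L (x, u x, deriv u x) ≤ ∫ x in Icc s t, L (x, w x, deriv w x))
    (hQ : ∀ᵐ x ∂volume.restrict (Icc s t), L (x, w x, deriv w x) ≤ L (x, u x, p) + Q)
    (hD : ∀ x ∈ Icc s t, (partialV L (x, u x, p) - l) ^ 2 ≤ D) :
    IntegrableOn (fun x => (deriv u x - p) ^ 2) (Icc s t) ∧
      ∫ x in Icc s t, (deriv u x - p) ^ 2 ≤ 4 / μ * (Q + D / μ) * (t - s) := by
  have huc : ContinuousOn u (Icc s t) := by
    have := hu.continuousOn; rwa [uIcc_of_le hst.le] at this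
  have hss : Icc s t ⊆ Icc a b := Icc_subset_Icc has htb
  have hvol : volume.real (Icc s t) = t - s := by
    rw [Measure.real, Real.volume_Icc, ENNReal.toReal_ofReal (by linarith)]
  have hc : ∀ c : ℝ, IntegrableOn (fun _ : ℝ => c) (Icc s t) := fun c =>
    integrableOn_const (by simp)
  have hLp : IntegrableOn (fun x => L (x, u x, p)) (Icc s t) :=
    (hL.comp (continuousOn_id.prodMk (huc.prodMk continuousOn_const))
      fun x hx => ⟨hss hx, mem_univ _⟩).integrableOn_Icc
  have hlin : IntegrableOn (fun x => l * (deriv u x - p)) (Icc s t) :=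
    ((hu.integrableOn_deriv hst.le).sub (hc p)).const_mul l
  have hlin0 : ∫ x in Icc s t, l * (deriv u x - p) = 0 := by
    rw [integral_const_mul,
      integral_sub (hu.integrableOn_deriv hst.le) (hc p),
      setIntegral_Icc_deriv_eq_sub hst.le hu, setIntegral_const, hvol, hp, smul_eq_mul]
    ring
  -- the error from freezing `L_v` is absorbed by half of the quadratic term
  have hpt : ∀ x ∈ Icc s t, μ / 4 * (deriv u x - p) ^ 2 ≤
      L (x, u x, deriv u x) - L (x, u x, p) - l * (deriv u x - p) + D / μ := by
    intro x hx
    have h1 := hE.tangent_le hμ (hss hx) (u x) p (deriv u x)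
    set ξ := deriv u x - p
    set e := partialV L (x, u x, p) - l with he
    have h2 : e ^ 2 / μ ≤ D / μ := by gcongr; exact hD x hx
    have h3 : 0 ≤ (2 * e + μ * ξ) ^ 2 / (4 * μ) := by positivity
    have h4 : (2 * e + μ * ξ) ^ 2 / (4 * μ) = e ^ 2 / μ + e * ξ + μ / 4 * ξ ^ 2 := by
      field_simp; ring
    have h5 : partialV L (x, u x, p) = e + l := by rw [he]; ring
    rw [h5] at h1
    linarith
  have hR : IntegrableOn (fun x =>
      L (x, u x, deriv u x) - L (x, u x, p) - l * (deriv u x - p) + D / μ) (Icc s t) :=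
    ((hint.sub hLp).sub hlin).add (hc _)
  have hsq : IntegrableOn (fun x => μ / 4 * (deriv u x - p) ^ 2) (Icc s t) := by
    refine Integrable.mono' hR
      ((((measurable_deriv u).sub_const p).pow_const 2).const_mul _).aestronglyMeasurable ?_
    filter_upwards [ae_restrict_mem measurableSet_Icc] with x hx
    rw [Real.norm_of_nonneg (by positivity)]
    exact hpt x hx
  have hsq' : IntegrableOn (fun x => (deriv u x - p) ^ 2) (Icc s t) := by
    refine (hsq.const_mul (4 / μ)).congr (.of_forall fun x => ?_)
    simp only
    field_simp
  refine ⟨hsq', ?_⟩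
  have h1 : μ / 4 * ∫ x in Icc s t, (deriv u x - p) ^ 2 ≤
      (∫ x in Icc s t, L (x, u x, deriv u x)) - (∫ x in Icc s t, L (x, u x, p)) +
        D / μ * (t - s) := by
    rw [← integral_const_mul]
    refine (setIntegral_mono_on hsq hR measurableSet_Icc hpt).trans_eq ?_
    have e1 := integral_add ((hint.sub hLp).sub hlin) (hc (D / μ))
    have e2 := integral_sub (hint.sub hLp) hlin
    have e3 := integral_sub hint hLp
    simp only [Pi.sub_apply] at e1 e2
    rw [e1, e2, e3, hlin0, setIntegral_const, hvol, smul_eq_mul]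
    ring
  have h2 : ∫ x in Icc s t, L (x, w x, deriv w x) ≤
      (∫ x in Icc s t, L (x, u x, p)) + Q * (t - s) := by
    refine (integral_mono_ae hintw (hLp.add (hc Q)) hQ).trans_eq ?_
    rw [integral_add' hLp (hc Q), setIntegral_const, hvol, smul_eq_mul, mul_comm]
  have h3 : μ / 4 * ∫ x in Icc s t, (deriv u x - p) ^ 2 ≤ (Q + D / μ) * (t - s) := by linarith
  calc ∫ x in Icc s t, (deriv u x - p) ^ 2
      = 4 / μ * (μ / 4 * ∫ x in Icc s t, (deriv u x - p) ^ 2) := by field_simp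
    _ ≤ 4 / μ * ((Q + D / μ) * (t - s)) := by gcongr
    _ = _ := by ring

/-! ### Rigidity of the chord slopes of a solution -/

/-- For a solution, chord slopes bounded by `M` change by at most a power of the length when a short
chord is replaced by one below it of at least half the length. The solution is compared with its
clipped chord. Crude bounds first show that the mean square of `u' - p` is bounded, so that `u`
varies on `[s,t]` by at most a multiple of `t - s`; with this the Hölder continuity of `L` makes the
errors in the comparison small, and the mean square is at most a multiple of a power of `t - s`. -/
theorem exists_abs_slope_sub_le_of_mem_solutions {a b : ℝ} (hab : a < b) {L : ℝ × ℝ × ℝ → ℝ}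
    (hL : ContinuousOn L (domain a b)) (hH : LocallyHolder a b L) (hE : GloballyElliptic a b L)
    {σ : ℝ≥0} (hσ : 0 < σ) {f g : ℝ → ℝ} (hf : C1Holder a b σ f) (hg : C1Holder a b σ g)
    (hfg : ∀ x ∈ Icc a b, f x < g x) {A B : ℝ} {u : ℝ → ℝ} (hu : u ∈ solutions a b A B L f g)
    (M : ℝ) (hM : 0 ≤ M) :
    ∃ C γ h₀ : ℝ, 0 ≤ C ∧ 0 < γ ∧ 0 < h₀ ∧ ∀ s x y t : ℝ,
      a ≤ s → s ≤ x → x < y → y ≤ t → t ≤ b → (t - s) / 2 ≤ y - x → t - s ≤ h₀ →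
      |slope u s t| ≤ M → |slope u x y - slope u s t| ≤ C * (t - s) ^ γ := by
  have hint := integrableOn_of_mem_solutions hab hL hE hf hg hfg hu
  have huac := hu.1.1
  have hfu := hu.1.2.2.2
  have huc : ContinuousOn u (Icc a b) := by
    have := huac.continuousOn; rwa [uIcc_of_le hab.le] at this
  obtain ⟨μ, hμ0, hμ⟩ := hE.bounded_below
  obtain ⟨Kf, hKf⟩ := hf.exists_lipschitzOnWith
  obtain ⟨Kg, hKg⟩ := hg.exists_lipschitzOnWith
  obtain ⟨Cf, hCf0, hCf⟩ := hf.exists_abs_deriv_sub_le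
  obtain ⟨Cg, hCg0, hCg⟩ := hg.exists_abs_deriv_sub_le
  obtain ⟨Rf, hRf⟩ := isCompact_Icc.exists_bound_of_continuousOn hKf.continuousOn
  obtain ⟨Rg, hRg⟩ := isCompact_Icc.exists_bound_of_continuousOn hKg.continuousOn
  set R := max Rf Rg
  have hR : ∀ x ∈ Icc a b, ∀ r, f x ≤ r → r ≤ g x → |r| ≤ R := fun x hx r h1 h2 =>
    (abs_le_max_abs_abs h1 h2).trans (max_le_max (hRf x hx) (hRg x hx))
  set Cσ := Cf + Cg
  have hCσ0 : 0 ≤ Cσ := by positivity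
  set N := M + Cσ + 1 with hN
  obtain ⟨K, hK0, hK⟩ := exists_bound hL hE R N
  obtain ⟨C₀, α, hC₀, hα, hHol⟩ := hH (Icc a b ×ˢ (Icc (-R) R ×ˢ Icc (-N) N))
    (isCompact_Icc.prod (isCompact_Icc.prod isCompact_Icc)) (prod_mono_right (subset_univ _))
  -- `C₁ (t - s)` is the crude bound for the integral of `(u' - p) ^ 2`
  set C₁ := 4 / μ * (2 * K + (2 * K) ^ 2 / μ) with hC₁
  have hC₁0 : 0 ≤ C₁ := by positivity
  set ρ := 2 + M + C₁ with hρ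
  have hρ0 : 0 < ρ := by positivity
  set γ : ℝ := min α σ with hγ
  have hγ0 : 0 < γ := lt_min hα (by exact_mod_cast hσ)
  set C₂ := 4 / μ * (C₀ * ρ ^ α + K * Cσ + ((2 + 2 * K) ^ 2 * (C₀ * ρ ^ α)) / μ) with hC₂
  have hC₂0 : 0 ≤ C₂ := by positivity
  obtain ⟨h₁, hh₁, hω₁⟩ := exists_pos_forall_mul_rpow_le
    (show 0 ≤ C₀ * ρ ^ α by positivity) hα one_pos
  refine ⟨1 / 2 + C₂, γ / 2, min 1 h₁, by positivity, by positivity, by positivity, ?_⟩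
  intro s x y t has hsx hxy hyt htb hhalf hh hpM
  set h := t - s with hhdef
  have hst : s < t := (hsx.trans_lt hxy).trans_le hyt
  have hh0 : 0 < h := sub_pos.2 hst
  have hh1 : h ≤ 1 := hh.trans (min_le_left _ _)
  have hss : Icc s t ⊆ Icc a b := Icc_subset_Icc has htb
  have husub := huac.mono_Icc has hst.le htb
  set p := slope u s t with hpdef
  have hp : u t - u s = p * (t - s) := by
    rw [hpdef, slope_def_field, div_mul_cancel₀ _ (sub_pos.2 hst).ne']
  have hsI : s ∈ Icc s t := left_mem_Icc.2 hst.le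
  have htI : t ∈ Icc s t := right_mem_Icc.2 hst.le
  set v : ℝ → ℝ := fun z => u s + p * (z - s) with hv
  have hvs : v s = u s := by simp [hv]
  have hvt : v t = u t := by simp only [hv]; linarith
  have hvd : ∀ y z, v z - v y = p * (z - y) := fun y z => by simp only [hv]; ring
  set w := clip f g v
  have hvL : LipschitzOnWith (Real.nnabs p) v (Icc s t) := by
    refine LipschitzOnWith.of_dist_le_mul fun y _ z _ => ?_
    rw [Real.dist_eq, Real.dist_eq, Real.coe_nnabs, ← abs_mul, hvd]
  have hwL := lipschitzOnWith_clip (hKf.mono hss) (hKg.mono hss) hvL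
  have hfs := hfu s (hss hsI)
  have hft := hfu t (hss htI)
  rw [← hvs] at hfs
  rw [← hvt] at hft
  have hws : w s = u s := (clip_eq hfs.1 hfs.2).trans hvs
  have hwt : w t = u t := (clip_eq hft.1 hft.2).trans hvt
  have hfw : ∀ x ∈ Icc s t, f x ≤ w x ∧ w x ≤ g x := fun x hx =>
    ⟨le_clip _ _ _ _, clip_le (hfg x (hss hx)).le _⟩
  have hle := setIntegral_le_of_mem_solutions hL hu hint has hst htb hwL hws hwt hfw
  have hintw := integrableOn_lagrangian_of_lipschitzOnWith hL has htb hwL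
  have hsqle := fun Q D l => integral_sq_le_of_comparison (Q := Q) (D := D) (l := l) hL hE hμ0 hμ
    has hst htb husub hp (hint.mono_set hss) hintw hle
  have hE0 : 0 ≤ h ^ (σ : ℝ) := by positivity
  have hσ1 : h ^ (σ : ℝ) ≤ 1 := Real.rpow_le_one hh0.le hh1 σ.2
  have hpN : |p| ≤ N := by linarith
  -- the derivative of the clipped chord
  have hw' : ∀ᵐ x ∂volume.restrict (Icc s t), |deriv w x - p| ≤ Cσ * h ^ (σ : ℝ) := by
    have hwac : AbsolutelyContinuousOnInterval w s t :=
      LipschitzOnWith.absolutelyContinuousOnInterval (by rwa [uIcc_of_le hst.le])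
    filter_upwards [ae_restrict_Icc_mem_Ioo s t, ae_restrict_of_ae hwac.ae_differentiableAt]
      with z hz hzd
    have hzd' := hzd (by rw [uIcc_of_le hst.le]; exact Ioo_subset_Icc_self hz)
    have hdist : ∀ y ∈ Ioo s t, ∀ z ∈ Ioo s t, |y - z| ≤ h := fun y hy z hz =>
      abs_le.2 ⟨by linarith [hy.1, hz.2], by linarith [hy.2, hz.1]⟩
    have hIoo : Ioo s t ⊆ Ioo a b := Ioo_subset_Ioo has htb
    refine abs_deriv_clip_sub_le has htb hKf.continuousOn (fun x hx => hf.differentiableAt hx)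
      hKg.continuousOn (fun x hx => hg.differentiableAt hx) (fun y hy z hz => ?_)
      (fun y hy z hz => ?_) hvd hfg hfs.1 hft.1 hfs.2 hft.2 hz hzd'
    · refine (hCf y (hIoo hy) z (hIoo hz) h (hdist y hy z hz)).trans ?_
      gcongr; linarith
    · refine (hCg y (hIoo hy) z (hIoo hz) h (hdist y hy z hz)).trans ?_
      gcongr; linarith
  have hw'N : ∀ x, |deriv w x - p| ≤ Cσ * h ^ (σ : ℝ) → |deriv w x| ≤ N := by
    intro x hx
    have h1 := abs_sub_abs_le_abs_sub (deriv w x) p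
    have h2 : Cσ * h ^ (σ : ℝ) ≤ Cσ := mul_le_of_le_one_right hCσ0 hσ1
    linarith
  have huR : ∀ x ∈ Icc s t, |u x| ≤ R := fun x hx =>
    hR x (hss hx) _ (hfu x (hss hx)).1 (hfu x (hss hx)).2
  have hwR : ∀ x ∈ Icc s t, |w x| ≤ R := fun x hx => hR x (hss hx) _ (hfw x hx).1 (hfw x hx).2
  -- the crude estimate
  obtain ⟨hsq, hcrude⟩ := hsqle (2 * K) ((2 * K) ^ 2) (partialV L (s, u s, p))
    (by
      filter_upwards [hw', ae_restrict_mem measurableSet_Icc] with z hz hzI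
      have h1 := abs_le.1 (hK z (hss hzI) (w z) _ (hwR z hzI) (hw'N z hz)).1
      have h2 := abs_le.1 (hK z (hss hzI) (u z) p (huR z hzI) hpN).1
      linarith)
    (fun z hz => by
      have h1 := abs_le.1 (hK z (hss hz) (u z) p (huR z hz) hpN).2.1
      have h2 := abs_le.1 (hK s (hss hsI) (u s) p (huR s hsI) hpN).2.1
      exact sq_le_sq' (by linarith) (by linarith))
  rw [← hC₁] at hcrude
  have hdev : ∀ z ∈ Icc s t, |u z - v z| ≤ (1 + C₁) * h := by
    intro z hz
    have h1 := abs_increment_sub_le (p := p) (ε := 1) husub hsq le_rfl hz.1 hz.2 one_pos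
    have h2 : u z - v z = u z - u s - p * (z - s) := by simp only [hv]; ring
    rw [h2]
    refine h1.trans ?_
    have h3 : z - s ≤ h := by linarith [hz.2]
    have h4 := mul_nonneg hC₁0 hh0.le
    rw [inv_one]
    linarith
  -- `ω` bounds the oscillation of `L` on the relevant set of points `(x, u)`
  set ω := C₀ * (ρ * h) ^ α with hω
  have hω0 : 0 < ω := by positivity
  have hωeq : ω = C₀ * ρ ^ α * h ^ α := by
    rw [hω, Real.mul_rpow hρ0.le hh0.le, mul_assoc]
  have hω1 : ω ≤ 1 := by
    rw [hωeq]; exact hω₁ h hh0.le (hh.trans (min_le_right _ _))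
  set η := √ω with hη
  have hη0 : 0 < η := Real.sqrt_pos.2 hω0
  have hη1 : η ≤ 1 := Real.sqrt_le_one.2 hω1
  have hη2 : η ^ 2 = ω := Real.sq_sqrt hω0.le
  have hosc : ∀ x₁ ∈ Icc s t, ∀ x₂ ∈ Icc s t, ∀ u₁ u₂ q, |u₁| ≤ R → |u₂| ≤ R → |q| ≤ N →
      |x₁ - x₂| + |u₁ - u₂| ≤ ρ * h → |L (x₁, u₁, q) - L (x₂, u₂, q)| ≤ ω := by
    intro x₁ hx₁ x₂ hx₂ u₁ u₂ q hu₁ hu₂ hq hd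
    refine (hHol x₁ u₁ q x₂ u₂ q ⟨hss hx₁, abs_le.1 hu₁, abs_le.1 hq⟩
      ⟨hss hx₂, abs_le.1 hu₂, abs_le.1 hq⟩).trans ?_
    rw [sub_self q, abs_zero, add_zero, hω]
    gcongr
  have hosc_u : ∀ z ∈ Icc s t, ∀ q, |q| ≤ N → |L (z, u z, q) - L (s, u s, q)| ≤ ω := by
    intro z hz q hq
    refine hosc z hz s hsI _ _ q (huR z hz) (huR s hsI) hq ?_
    have h1 := hdev z hz
    have h2 : u z - u s = (u z - v z) + p * (z - s) := by simp only [hv]; ring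
    have h3 : |z - s| ≤ h := by rw [abs_of_nonneg (by linarith [hz.1])]; linarith [hz.2]
    have h4 : |p * (z - s)| ≤ M * h := by rw [abs_mul]; gcongr
    have h5 : |u z - u s| ≤ |u z - v z| + |p * (z - s)| := by rw [h2]; exact abs_add_le _ _
    have h6 : ρ * h = h + (1 + C₁) * h + M * h := by rw [hρ]; ring
    linarith
  have hosc_w : ∀ z ∈ Icc s t, |L (z, w z, p) - L (z, u z, p)| ≤ ω := by
    intro z hz
    refine hosc z hz z hz _ _ p (hwR z hz) (huR z hz) hpN ?_
    have h1 := abs_clip_sub_le (v := v) (hfu z (hss hz)).1 (hfu z (hss hz)).2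
    rw [abs_sub_comm (v z)] at h1
    have h2 := hdev z hz
    have h3 : ρ * h = (1 + C₁) * h + (1 + M) * h := by rw [hρ]; ring
    have h4 : 0 ≤ (1 + M) * h := by positivity
    rw [sub_self, abs_zero, zero_add]
    linarith
  -- the fine estimate
  have hfine := (hsqle (ω + K * (Cσ * h ^ (σ : ℝ))) ((2 + 2 * K) ^ 2 * ω)
    (partialV L (s, u s, p))
    (by
      filter_upwards [hw', ae_restrict_mem measurableSet_Icc] with z hz hzI
      have h1 := hE.abs_sub_le (hss hzI) (fun q hq => (hK z (hss hzI) (w z) q (hwR z hzI) hq).2.1)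
        hpN (hw'N z hz)
      have h2 := (abs_le.1 (hosc_w z hzI)).2
      have h3 : K * |deriv w z - p| ≤ K * (Cσ * h ^ (σ : ℝ)) := by gcongr
      linarith [(abs_le.1 h1).2])
    (fun z hz => by
      have hq : ∀ q ∈ Icc p (p + η), |q| ≤ N := by
        intro q hq
        have := abs_le.1 hpM
        exact abs_le.2 ⟨by linarith [hq.1], by linarith [hq.2]⟩
      have h1 := hE.abs_partialV_sub_le hη0 (hss hz) (hss hsI)
        (fun q hq' => (hK z (hss hz) (u z) q (huR z hz) (hq q hq')).2.2)
        (fun q hq' => (hK s (hss hsI) (u s) q (huR s hsI) (hq q hq')).2.2)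
        (hη2 ▸ hosc_u z hz p hpN)
        (hη2 ▸ hosc_u z hz (p + η) (hq _ (right_mem_Icc.2 (by linarith))))
      rw [← hη2, ← mul_pow]
      exact sq_le_sq' (abs_le.1 h1).1 (abs_le.1 h1).2)).2
  set I := ∫ x in Icc s t, (deriv u x - p) ^ 2
  have hI : I ≤ C₂ * h ^ γ * h := by
    refine hfine.trans ?_
    have h1 : ω ≤ C₀ * ρ ^ α * h ^ γ := by
      rw [hωeq]
      gcongr ?_ * ?_
      exact Real.rpow_le_rpow_of_exponent_ge hh0 hh1 (min_le_left _ _)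
    have h2 : h ^ (σ : ℝ) ≤ h ^ γ :=
      Real.rpow_le_rpow_of_exponent_ge hh0 hh1 (min_le_right _ _)
    calc 4 / μ * (ω + K * (Cσ * h ^ (σ : ℝ)) + (2 + 2 * K) ^ 2 * ω / μ) * h
        ≤ 4 / μ * (C₀ * ρ ^ α * h ^ γ + K * (Cσ * h ^ γ) +
            (2 + 2 * K) ^ 2 * (C₀ * ρ ^ α * h ^ γ) / μ) * h := by gcongr
      _ = C₂ * h ^ γ * h := by rw [hC₂]; ring
  -- a parameter of the order of the square root of the mean square of `u' - p` is optimal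
  set ε := h ^ (γ / 2) with hε
  have hε0 : 0 < ε := by positivity
  have hεγ : h ^ γ = ε * ε := by rw [hε, ← Real.rpow_add hh0, add_halves]
  have hinc := abs_increment_sub_le husub hsq hsx hxy.le hyt hε0
  have hyx : 0 < y - x := sub_pos.2 hxy
  have hslope : u y - u x - p * (y - x) = (slope u x y - p) * (y - x) := by
    rw [slope_def_field]; field_simp
  rw [hslope, abs_mul, abs_of_pos hyx] at hinc
  refine le_of_mul_le_mul_right (hinc.trans ?_) hyx
  have h1 : ε⁻¹ * I ≤ C₂ * ε * (2 * (y - x)) := by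
    calc ε⁻¹ * I ≤ ε⁻¹ * (C₂ * h ^ γ * h) := by gcongr
      _ = C₂ * ε * h := by rw [hεγ]; field_simp
      _ ≤ C₂ * ε * (2 * (y - x)) := by gcongr; linarith
  calc (ε * (y - x) + ε⁻¹ * I) / 2 ≤ (ε * (y - x) + C₂ * ε * (2 * (y - x))) / 2 := by gcongr
    _ = (1 / 2 + C₂) * ε * (y - x) := by ring

end ObstacleProblem

theorem mainTheorem4 (a b : ℝ) (hab : a < b) (L : ℝ × ℝ × ℝ → ℝ)
    (hL : ContinuousOn L (ObstacleProblem.domain a b))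
    (hH1 : ObstacleProblem.LocallyHolder a b L)
    (hH2 : ObstacleProblem.GloballyElliptic a b L)
    (σ : ℝ≥0) (hσ : 0 < σ) (hσ1 : σ ≤ 1) (f g : ℝ → ℝ)
    (hf : ObstacleProblem.C1Holder a b σ f) (hg : ObstacleProblem.C1Holder a b σ g)
    (hfg : ∀ x ∈ Icc a b, f x < g x) (A B : ℝ) (u : ℝ → ℝ)
    (hu : u ∈ ObstacleProblem.solutions a b A B L f g) :
    ObstacleProblem.TonelliPartialRegularity a b u :=
  (ObstacleProblem.rigidSlopes_of_half
    (ObstacleProblem.exists_abs_slope_sub_le_of_mem_solutions hab hL hH1 hH2 hσ hf hg hfg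
      hu)).tonelliPartialRegularity hab hu.1.1
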